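/- A metric Lie algebra is a finite-dimensional real Lie algebra $\mathfrak n$ with an inner product $\langle\cdot,\cdot\rangle$ (equivalently, a simply connected Lie group with a left-invariant Riemannian metric). Its Levi-Civita connection is given by $2\langle\nabla_XY,Z\rangle=\langle[X,Y],Z\rangle-\langle[Y,Z],X\rangle+\langle[Z,X],Y\rangle$, its Ricci tensor by $\mathrm{ric}(Y,Z)=\mathrm{tr}\,(X\mapsto R(X,Y)Z)$ with $R(X,Y)=[\nabla_X,\nabla_Y]-\nabla_{[X,Y]}$, and its Ricci operator by $\langle\mathrm{Ric}\,Y,Z\rangle=\mathrm{ric}(Y,Z)$. The metric is an algebraic Ricci soliton if $\mathrm{Ric}=c\,\mathrm{Id}+D$ for some $c\in\mathbb R$ and some derivation $D$ of $\mathfrak n$; if moreover $\mathfrak n$ is nilpotent, it is a nilsoliton. Let $\{E_1,\dots,E_5\}$ be an orthonormal basis of a five-dimensional metric Lie algebra whose only non-zero brackets (up to skew-symmetry) are those listed in one of the ten cases below, with real parameters in the given range; all unlisted parameter restrictions are absent. For all such parameters these brackets do define a Lie algebra, it is nilpotent, and it is a nilsoliton exactly under the stated condition; when it is, $c$ and $D$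 are unique and are as stated ($d(\dots)$ denotes a diagonal matrix in the basis $E_1,\dots,E_5$). 1. (2.1) $[E_1,E_2]=sE_5$, $[E_3,E_4]=mE_5$, $s\ge m>0$: nilsoliton iff $s=m$; $c=-2m^2$, $D=d(\frac32m^2,\frac32m^2,\frac32m^2,\frac32m^2,3m^2)$. 2. (2.2) $[E_1,E_2]=mE_4$, $[E_1,E_3]=sE_5$, $m\ge s>0$: nilsoliton iff $s=m$; $c=-2m^2$, $D=d(m^2,\frac32m^2,\frac32m^2,\frac52m^2,\frac52m^2)$. 3. (2.3) $[E_1,E_2]=mE_3$, $m>0$: always a nilsoliton; $c=-\frac32m^2$, $D=d(m^2,m^2,2m^2,\frac32m^2,\frac32m^2)$. 4. ($\mathfrak l_{5,7}$, case A) $[E_1,E_2]=mE_3+sE_4+uE_5$, $[E_1,E_3]=vE_4+wE_5$, $[E_1,E_4]=xE_5$, $m,v,x>0$, $s=0$, $w\ge0$: nilsoliton iff $x=m$, $u=w=s=0$ and $v=\frac{2}{\sqrt3}m$; $c=-2m^2$, $D=d(\frac13m^2,\frac32m^2,\frac{11}6m^2,\frac{13}6m^2,\frac52m^2)$. 5.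 ($\mathfrak l_{5,7}$, case B) the same brackets with $m,v,x>0$ and $s>0$: never a nilsoliton. 6. ($\mathfrak l_{5,6}$, case A) $[E_1,E_2]=mE_3+sE_4+uE_5$, $[E_1,E_3]=vE_4+wE_5$, $[E_1,E_4]=xE_5$, $[E_2,E_3]=yE_5$, $m,v,x,y\ne0$, $s=0$, $w\ge0$: nilsoliton iff $u=w=s=0$, $m=\pm\sqrt{3/2}\,x$, $v=\pm\sqrt{3/2}\,x$ and $y=\pm x$, the three signs being independent of each other; $c=-\frac{11}4x^2$, $D=d(\frac34x^2,\frac32x^2,\frac94x^2,3x^2,\frac{15}4x^2)$. 7. ($\mathfrak l_{5,6}$, case B) the same brackets with $m,v,x,y\ne0$ and $s>0$: never a nilsoliton. 8. ($\mathfrak l_{5,5}$) $[E_1,E_2]=mE_4+sE_5$, $[E_1,E_3]=uE_5$, $[E_1,E_4]=vE_5$, $[E_2,E_3]=wE_5$, $s,u\ge0$, $m,v,w>0$: nilsoliton iff $s=u=0$, $v=m$ and $w=\frac{\sqrt2}2m$; $c=-\frac74m^2$, $D=d(\frac34m^2,m^2,\frac32m^2,\frac74m^2,\frac52m^2)$.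 9. ($\mathfrak l_{5,9}$, case A) $[E_1,E_2]=mE_3+sE_4+uE_5$, $[E_1,E_3]=vE_4$, $[E_2,E_3]=wE_5$, $m>0$, $w>v>0$, $s,u\ge0$: never a nilsoliton. 10. ($\mathfrak l_{5,9}$, case B) the same brackets with $m,v>0$, $w=v$, $s\ge0$, $u=0$: nilsoliton iff $s=0$ and $v=\frac{\sqrt3}2m$; $c=-\frac32m^2$, $D=d(\frac58m^2,\frac58m^2,\frac54m^2,\frac{15}8m^2,\frac{15}8m^2)$. The nilsolitons found are Lauret's classes $\mu_1',\dots,\mu_7'$: a metric Lie algebra is a nilsoliton belonging to family 4, 6, 8, 1, 10, 2, 3, respectively (for some parameters in the given range and some orthonormal basis), if and only if, up to isometric isomorphism and multiplication of the inner product by a positive constant, it is $\mathbb R^5$ with orthonormal standard basis $e_1,\dots,e_5$ and the bracket - $\mu_1'$: $[e_1,e_2]=\sqrt3e_3$, $[e_1,e_3]=2e_4$, $[e_1,e_4]=\sqrt3e_5$; - $\mu_2'$: $[e_1,e_2]=\sqrt3e_3$, $[e_1,e_3]=\sqrt3e_4$, $[e_1,e_4]=\sqrt2e_5$, $[e_2,e_3]=\sqrt2e_5$;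 - $\mu_3'$: $[e_1,e_2]=\sqrt2e_4$, $[e_1,e_4]=\sqrt2e_5$, $[e_2,e_3]=e_5$; - $\mu_4'$: $[e_1,e_2]=e_5$, $[e_3,e_4]=e_5$; - $\mu_5'$: $[e_1,e_2]=2e_3$, $[e_1,e_3]=\sqrt3e_4$, $[e_2,e_3]=\sqrt3e_5$; - $\mu_6'$: $[e_1,e_2]=e_4$, $[e_1,e_3]=e_5$; - $\mu_7'$: $[e_1,e_2]=e_3$. These seven classes are pairwise different (no metric Lie algebra belongs to two of them). -/

import Mathlib

universe u

/-- A finite-dimensional metric Lie algebra: a real Lie algebra with an inner product, that is, a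
simply connected Lie group with a left-invariant Riemannian metric, seen at the identity. -/
structure MetricLieAlgebra where
  carrier : Type u
  [lieRing : LieRing carrier]
  [lieAlgebra : LieAlgebra ℝ carrier]
  [finite : Module.Finite ℝ carrier]
  /-- the inner product -/
  metric : LinearMap.BilinForm ℝ carrier
  metric_symm : ∀ x y, metric x y = metric y x
  metric_pos : ∀ x, x ≠ 0 → 0 < metric x x

namespace MetricLieAlgebra

attribute [instance] lieRing lieAlgebra finite

instance : CoeSort MetricLieAlgebra.{u} (Type u) := ⟨carrier⟩

variable (A : MetricLieAlgebra.{u})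

theorem metric_nondegenerate : A.metric.Nondegenerate := by
  constructor
  · intro x hx
    by_contra h
    exact absurd (hx x) (A.metric_pos x h).ne'
  · intro x hx
    by_contra h
    exact absurd (hx x) (A.metric_pos x h).ne'

/-- The Riesz isomorphism `x ↦ ⟨x, ·⟩`. -/
noncomputable def flat : A ≃ₗ[ℝ] Module.Dual ℝ A :=
  A.metric.toDual A.metric_nondegenerate

theorem metric_flat_symm (f : Module.Dual ℝ A) (z : A) : A.metric (A.flat.symm f) z = f z :=
  LinearMap.BilinForm.apply_toDual_symm_apply f z

/-- The Levi-Civita connection `x ↦ y ↦ ∇ₓ y` on left-invariant vector fields, by Koszul's formula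
`2 ⟨∇ₓ y, z⟩ = ⟨[x, y], z⟩ - ⟨[y, z], x⟩ + ⟨[z, x], y⟩`. -/
noncomputable def leviCivita : A →ₗ[ℝ] A →ₗ[ℝ] A :=
  LinearMap.mk₂ ℝ
    (fun x y => A.flat.symm ((1 / 2 : ℝ) •
      (A.metric ⁅x, y⁆ - (A.metric x).comp (LieAlgebra.ad ℝ A y)
        - (A.metric y).comp (LieAlgebra.ad ℝ A x))))
    (by
      intro x x' y
      rw [← map_add]
      congr 1
      ext z
      simp
      ring)
    (by
      intro c x y
      rw [← map_smul]
      congr 1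
      ext z
      simp
      ring)
    (by
      intro x y y'
      rw [← map_add]
      congr 1
      ext z
      simp
      ring)
    (by
      intro c x y
      rw [← map_smul]
      congr 1
      ext z
      simp
      ring)

theorem metric_skew (x y z : A) : A.metric ⁅x, y⁆ z = - A.metric ⁅y, x⁆ z := by
  rw [← LinearMap.neg_apply, ← map_neg, lie_skew]

theorem koszul (x y z : A) : A.metric (A.leviCivita x y) z =
    1 / 2 * (A.metric ⁅x, y⁆ z - A.metric ⁅y, z⁆ x + A.metric ⁅z, x⁆ y) := by
  have h : A.metric y ⁅x, z⁆ = - A.metric ⁅z, x⁆ y := by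
    rw [A.metric_symm, metric_skew]
  simp only [leviCivita, LinearMap.mk₂_apply, metric_flat_symm]
  simp [h, A.metric_symm x]

/-- The connection is torsion-free. -/
theorem leviCivita_torsionFree (x y : A) : A.leviCivita x y - A.leviCivita y x = ⁅x, y⁆ := by
  apply A.flat.injective
  ext z
  change A.metric _ z = A.metric _ z
  have h1 : A.metric ⁅y, x⁆ z = - A.metric ⁅x, y⁆ z := A.metric_skew _ _ _
  have h2 : A.metric ⁅x, z⁆ y = - A.metric ⁅z, x⁆ y := A.metric_skew _ _ _
  have h3 : A.metric ⁅z, y⁆ x = - A.metric ⁅y, z⁆ x := A.metric_skew _ _ _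
  rw [map_sub, LinearMap.sub_apply, koszul, koszul, h1, h2, h3]
  ring

/-- The connection is compatible with the inner product. -/
theorem leviCivita_metric (x y z : A) :
    A.metric (A.leviCivita x y) z + A.metric y (A.leviCivita x z) = 0 := by
  have h1 : A.metric ⁅z, y⁆ x = - A.metric ⁅y, z⁆ x := A.metric_skew _ _ _
  have h2 : A.metric ⁅x, z⁆ y = - A.metric ⁅z, x⁆ y := A.metric_skew _ _ _
  have h3 : A.metric ⁅x, y⁆ z = - A.metric ⁅y, x⁆ z := A.metric_skew _ _ _
  rw [A.metric_symm y, koszul, koszul, h1, h2, h3]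
  ring

/-- The Riemann curvature tensor `R(x, y) z = ∇ₓ ∇_y z - ∇_y ∇ₓ z - ∇_[x, y] z`. -/
noncomputable def curvature (x y z : A) : A :=
  A.leviCivita x (A.leviCivita y z) - A.leviCivita y (A.leviCivita x z) - A.leviCivita ⁅x, y⁆ z

/-- The endomorphism `x ↦ R(x, y) z`. -/
noncomputable def curvatureEnd (y z : A) : A →ₗ[ℝ] A where
  toFun x := A.curvature x y z
  map_add' x x' := by
    simp only [curvature, map_add, LinearMap.add_apply, add_lie]
    abel
  map_smul' c x := by
    simp only [curvature, map_smul, LinearMap.smul_apply, smul_lie, smul_sub, RingHom.id_apply]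

/-- The Ricci tensor `ric(y, z) = tr (x ↦ R(x, y) z)`. -/
noncomputable def ricci : LinearMap.BilinForm ℝ A :=
  LinearMap.mk₂ ℝ (fun y z => LinearMap.trace ℝ A (A.curvatureEnd y z))
    (by
      intro y y' z
      rw [← map_add]
      congr 1
      ext x
      simp only [curvatureEnd, curvature, LinearMap.coe_mk, AddHom.coe_mk, LinearMap.add_apply,
        map_add, lie_add]
      abel)
    (by
      intro c y z
      rw [← map_smul]
      congr 1
      ext x
      simp only [curvatureEnd, curvature, LinearMap.coe_mk, AddHom.coe_mk, LinearMap.smul_apply,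
        map_smul, lie_smul, smul_sub])
    (by
      intro y z z'
      rw [← map_add]
      congr 1
      ext x
      simp only [curvatureEnd, curvature, LinearMap.coe_mk, AddHom.coe_mk, LinearMap.add_apply,
        map_add]
      abel)
    (by
      intro c y z
      rw [← map_smul]
      congr 1
      ext x
      simp only [curvatureEnd, curvature, LinearMap.coe_mk, AddHom.coe_mk, LinearMap.smul_apply,
        map_smul, smul_sub])

/-- The Ricci operator, i.e. the (1,1)-Ricci tensor: `⟨Ric y, z⟩ = ric(y, z)`. -/
noncomputable def ricciOperator : A →ₗ[ℝ] A :=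
  A.flat.symm.toLinearMap ∘ₗ A.ricci

theorem metric_ricciOperator (y z : A) : A.metric (A.ricciOperator y) z = A.ricci y z :=
  A.metric_flat_symm _ z

/-- `Ric = c Id + D`, where `D` is a derivation of the Lie algebra. -/
def SolitonEquation (c : ℝ) (D : LieDerivation ℝ A A) : Prop :=
  A.ricciOperator = c • LinearMap.id + D.toLinearMap

/-- The inner product is an algebraic Ricci soliton. -/
def IsAlgebraicRicciSoliton : Prop :=
  ∃ (c : ℝ) (D : LieDerivation ℝ A A), A.SolitonEquation c D

/-- A nilsoliton: an algebraic Ricci soliton on a nilpotent Lie algebra. -/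
def IsNilsoliton : Prop :=
  LieRing.IsNilpotent A ∧ A.IsAlgebraicRicciSoliton

/-- `E` is an orthonormal basis with structure constants `α`: `[E i, E j] = ∑ k, α i j k E k`. -/
structure IsOrthonormalFrame (E : Module.Basis (Fin 5) ℝ A) (α : Fin 5 → Fin 5 → Fin 5 → ℝ) :
    Prop where
  metric_eq : ∀ i j, A.metric (E i) (E j) = if i = j then 1 else 0
  lie_eq : ∀ i j, ⁅E i, E j⁆ = ∑ k, α i j k • E k

/-- The metric Lie algebra has structure constants `α` in some orthonormal basis; this describes
an isometry class of metric Lie algebras. -/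
def HasStructureConstants (α : Fin 5 → Fin 5 → Fin 5 → ℝ) : Prop :=
  ∃ E : Module.Basis (Fin 5) ℝ A, A.IsOrthonormalFrame E α

/-- Up to multiplying the inner product by a positive constant, the metric Lie algebra is
isometrically isomorphic to `ℝ⁵` with the standard inner product and the structure constants `β`. -/
def IsHomotheticTo (β : Fin 5 → Fin 5 → Fin 5 → ℝ) : Prop :=
  ∃ (F : Module.Basis (Fin 5) ℝ A) (r : ℝ), 0 < r ∧
    (∀ i j, A.metric (F i) (F j) = if i = j then r else 0) ∧
    ∀ i j, ⁅F i, F j⁆ = ∑ k, β i j k • F k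

/-- In the basis `E` the derivation `D` is the diagonal matrix with entries `d`. -/
def IsDiagonal (E : Module.Basis (Fin 5) ℝ A) (D : LieDerivation ℝ A A) (d : Fin 5 → ℝ) : Prop :=
  ∀ i, D (E i) = d i • E i

end MetricLieAlgebra

/-- The structure constants of the bracket `[E i, E j] = t E k = -[E j, E i]`, all other brackets of
basis vectors being zero (for `i ≠ j`). The basis vectors are numbered `E 0, …, E 4`. Brackets
with several nonzero terms are sums of these. -/
def bracketTerm (i j k : Fin 5) (t : ℝ) : Fin 5 → Fin 5 → Fin 5 → ℝ := fun a b c =>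
  if a = i ∧ b = j ∧ c = k then t else if a = j ∧ b = i ∧ c = k then -t else 0

/-- Two-step, one-dimensional centre. -/
def heis5 (s m : ℝ) : Fin 5 → Fin 5 → Fin 5 → ℝ :=
  bracketTerm 0 1 4 s + bracketTerm 2 3 4 m

/-- Two-step, two-dimensional centre. -/
def twoStepCentre2 (m s : ℝ) : Fin 5 → Fin 5 → Fin 5 → ℝ :=
  bracketTerm 0 1 3 m + bracketTerm 0 2 4 s

/-- Two-step, three-dimensional centre. -/
def twoStepCentre3 (m : ℝ) : Fin 5 → Fin 5 → Fin 5 → ℝ :=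
  bracketTerm 0 1 2 m

/-- The family `𝔩_{5,7}`. -/
def l57 (m s u v w x : ℝ) : Fin 5 → Fin 5 → Fin 5 → ℝ :=
  bracketTerm 0 1 2 m + bracketTerm 0 1 3 s + bracketTerm 0 1 4 u
    + bracketTerm 0 2 3 v + bracketTerm 0 2 4 w + bracketTerm 0 3 4 x

/-- The family `𝔩_{5,6}`. -/
def l56 (m s u v w x y : ℝ) : Fin 5 → Fin 5 → Fin 5 → ℝ :=
  bracketTerm 0 1 2 m + bracketTerm 0 1 3 s + bracketTerm 0 1 4 u
    + bracketTerm 0 2 3 v + bracketTerm 0 2 4 w + bracketTerm 0 3 4 x + bracketTerm 1 2 4 y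

/-- The family `𝔩_{5,5}`. -/
def l55 (m s u v w : ℝ) : Fin 5 → Fin 5 → Fin 5 → ℝ :=
  bracketTerm 0 1 3 m + bracketTerm 0 1 4 s + bracketTerm 0 2 4 u
    + bracketTerm 0 3 4 v + bracketTerm 1 2 4 w

/-- The family `𝔩_{5,9}`. -/
def l59 (m s u v w : ℝ) : Fin 5 → Fin 5 → Fin 5 → ℝ :=
  bracketTerm 0 1 2 m + bracketTerm 0 1 3 s + bracketTerm 0 1 4 u
    + bracketTerm 0 2 3 v + bracketTerm 1 2 4 w

/-- Lauret's five-dimensional nilsolitons `μ'₁, …, μ'₇` (numbered from `0`), each up to scaling. -/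
noncomputable def lauret : Fin 7 → Fin 5 → Fin 5 → Fin 5 → ℝ :=
  ![bracketTerm 0 1 2 √3 + bracketTerm 0 2 3 2 + bracketTerm 0 3 4 √3,
    bracketTerm 0 1 2 √3 + bracketTerm 0 2 3 √3 + bracketTerm 0 3 4 √2 + bracketTerm 1 2 4 √2,
    bracketTerm 0 1 3 √2 + bracketTerm 0 3 4 √2 + bracketTerm 1 2 4 1,
    bracketTerm 0 1 4 1 + bracketTerm 2 3 4 1,
    bracketTerm 0 1 2 2 + bracketTerm 0 2 3 √3 + bracketTerm 1 2 4 √3,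
    bracketTerm 0 1 3 1 + bracketTerm 0 2 4 1,
    bracketTerm 0 1 2 1]

/-! In an orthonormal frame the Ricci tensor is a quadratic polynomial in the structure constants.
`Ric - c Id` is a derivation exactly when finitely many polynomials vanish, since Leibniz' rule is
bilinear and can be tested on a basis. So each case becomes a polynomial system in the parameters
and `c`.

All families sit inside one eight-parameter bracket, `triangularBracket`, so Ricci and the soliton
system are computed once (`ricciMatrix_triangularBracket`, `soliton_conditions`). Components outside
the support of the bracket see only off-diagonal Ricci entries. In the families with extra
parameters `s`, `u`, `w`, monomial components of the system force these to vanish one after another,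
which already excludes the two cases with `s > 0`.

After that Ricci is diagonal. With weight `ω = e_k - e_i - e_j` for a bracket `[E i, E j] = t E k`,
the diagonal of Ricci is half the sum of the vectors `t² ω`. Each nonzero structure constant then
gives one linear equation: the squares of the constants, weighted by the inner products of the
weights, sum to `-2c`. These linear systems fix `c` and the ratios of the squares, and the sign
conditions on the parameters do the rest. The derivation is `Ric - c Id`, read off the diagonal.

Rescaling the frame, with sign changes for `l56`, identifies the solutions with Lauret's models. The
models are told apart by the ratios of `tr Ric^n` to `(tr Ric)^n`, which are invariant under
isometry and scaling; `n = 2` and `n = 3` suffice (`lauret_injective`). -/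

namespace MetricLieAlgebra

/-! ### Ricci tensor and soliton equation in an orthonormal frame -/

/-- The Christoffel symbols `⟨∇_{E i} E j, E k⟩` in an orthonormal frame with structure
constants `α`. -/
noncomputable def christoffel (α : Fin 5 → Fin 5 → Fin 5 → ℝ) (i j k : Fin 5) : ℝ :=
  1 / 2 * (α i j k - α j k i + α k i j)

/-- The components of the Ricci tensor in an orthonormal frame with structure constants `α`. -/
noncomputable def ricciMatrix (α : Fin 5 → Fin 5 → Fin 5 → ℝ) (j k : Fin 5) : ℝ :=
  ∑ i, ∑ l, (christoffel α j k l * christoffel α i l i - christoffel α i k l * christoffel α j l i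
    - α i j l * christoffel α l k i)

/-- The obstruction for `Ric - c Id` to be a derivation, in components. -/
noncomputable def solitonDefect (α : Fin 5 → Fin 5 → Fin 5 → ℝ) (c : ℝ) (i j k : Fin 5) : ℝ :=
  ∑ l, (α i j l * ricciMatrix α l k - ricciMatrix α i l * α l j k - ricciMatrix α j l * α i l k)
    + c * α i j k

/-- The endomorphism `Ric - c Id`. -/
noncomputable def ricciShift (A : MetricLieAlgebra.{u}) (c : ℝ) : A →ₗ[ℝ] A :=
  A.ricciOperator - c • LinearMap.id

namespace IsOrthonormalFrame

variable {A : MetricLieAlgebra.{u}} {E : Module.Basis (Fin 5) ℝ A}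
  {α : Fin 5 → Fin 5 → Fin 5 → ℝ} (h : A.IsOrthonormalFrame E α)
include h

theorem metric_sum_left (f : Fin 5 → ℝ) (k : Fin 5) : A.metric (∑ i, f i • E i) (E k) = f k := by
  simp [h.metric_eq]

theorem metric_lie (i j k : Fin 5) : A.metric ⁅E i, E j⁆ (E k) = α i j k := by
  rw [h.lie_eq, h.metric_sum_left]

theorem eq_sum_metric (x : A) : x = ∑ k, A.metric x (E k) • E k := by
  conv_lhs => rw [← E.sum_repr x]
  refine Finset.sum_congr rfl fun k _ => ?_
  conv_rhs => rw [← E.sum_repr x, h.metric_sum_left]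

theorem repr_eq_metric (x : A) (k : Fin 5) : E.repr x k = A.metric x (E k) := by
  conv_rhs => rw [← E.sum_repr x, h.metric_sum_left]

theorem leviCivita_eq (i j : Fin 5) :
    A.leviCivita (E i) (E j) = ∑ k, christoffel α i j k • E k := by
  rw [h.eq_sum_metric (A.leviCivita (E i) (E j))]
  simp only [koszul, h.metric_lie, christoffel]

theorem ricci_eq (j k : Fin 5) : A.ricci (E j) (E k) = ricciMatrix α j k := by
  change LinearMap.trace ℝ A (A.curvatureEnd (E j) (E k)) = _
  rw [LinearMap.trace_eq_matrix_trace ℝ E, Matrix.trace]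
  refine Finset.sum_congr rfl fun i _ => ?_
  rw [Matrix.diag_apply, LinearMap.toMatrix_apply, h.repr_eq_metric]
  change A.metric (A.curvature (E i) (E j) (E k)) (E i) = _
  simp only [curvature, h.leviCivita_eq, h.lie_eq, map_sum, map_smul, LinearMap.sum_apply,
    LinearMap.smul_apply, map_sub, LinearMap.sub_apply, smul_eq_mul, Finset.sum_sub_distrib, h.metric_eq,
    mul_ite, mul_one, mul_zero,
    Finset.sum_ite_eq', Finset.mem_univ, if_true]

theorem ricciOperator_eq (j : Fin 5) : A.ricciOperator (E j) = ∑ k, ricciMatrix α j k • E k := by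
  rw [h.eq_sum_metric (A.ricciOperator (E j))]
  simp only [metric_ricciOperator, h.ricci_eq]

theorem derivation_eq {c : ℝ} {D : LieDerivation ℝ A A} (hD : A.SolitonEquation c D) (j : Fin 5) :
    D (E j) = ∑ k, ricciMatrix α j k • E k - c • E j := by
  have := congrArg (fun f => f (E j)) hD
  simp only [LinearMap.add_apply, LinearMap.smul_apply, LinearMap.id_apply] at this
  rw [← h.ricciOperator_eq, this]
  simp

/-- The bridge between polynomials and derivations, used in both directions: the defect is a
component of the failure of Leibniz' rule for `Ric - c Id`. -/
theorem solitonDefect_eq_metric (c : ℝ) (i j k : Fin 5) :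
    solitonDefect α c i j k = A.metric (A.ricciShift c ⁅E i, E j⁆
      - ⁅A.ricciShift c (E i), E j⁆ - ⁅E i, A.ricciShift c (E j)⁆) (E k) := by
  simp only [ricciShift, LinearMap.sub_apply, LinearMap.smul_apply, LinearMap.id_apply, sub_lie,
    lie_sub,
    smul_lie, lie_smul, h.ricciOperator_eq, h.lie_eq, map_sub, map_smul, map_sum,
    LinearMap.sum_apply, smul_eq_mul, sum_lie, lie_sum, solitonDefect, Finset.sum_sub_distrib, h.metric_eq, mul_ite,
    mul_sub, mul_one, mul_zero, Finset.sum_ite_eq', Finset.mem_univ, if_true]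
  ring

theorem solitonDefect_eq_zero {c : ℝ} {D : LieDerivation ℝ A A} (hD : A.SolitonEquation c D)
    (i j k : Fin 5) : solitonDefect α c i j k = 0 := by
  have hD' : A.ricciShift c = D.toLinearMap := by
    rw [ricciShift, hD, add_sub_cancel_left]
  rw [h.solitonDefect_eq_metric, hD']
  simp only [LieDerivation.coeFn_coe, LieDerivation.apply_lie_eq_add]
  simp

/-- Both sides of Leibniz' rule are bilinear, so the vanishing of the defect on basis vectors makes
`Ric - c Id` itself the required derivation. -/
theorem exists_solitonEquation {c : ℝ} (hc : ∀ i j k, solitonDefect α c i j k = 0) :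
    ∃ D : LieDerivation ℝ A A, A.SolitonEquation c D := by
  set T := A.ricciShift c with hT
  have key : ∀ i j, T ⁅E i, E j⁆ = ⁅T (E i), E j⁆ + ⁅E i, T (E j)⁆ := by
    intro i j
    rw [← sub_eq_zero, ← sub_sub, h.eq_sum_metric (T ⁅E i, E j⁆ - ⁅T (E i), E j⁆ - ⁅E i, T (E j)⁆)]
    refine Finset.sum_eq_zero fun k _ => ?_
    rw [← h.solitonDefect_eq_metric, hc, zero_smul]
  let B : A →ₗ[ℝ] A →ₗ[ℝ] A := LieModule.toEnd ℝ A A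
  have hB : B.compr₂ T = B.comp T + B.compl₂ T := by
    refine E.ext fun i => E.ext fun j => ?_
    simpa [B] using key i j
  refine ⟨⟨T, fun x y => ?_⟩, ?_⟩
  · have := congrArg (fun f => f x y) hB
    simp only [B, LinearMap.compr₂_apply, LinearMap.add_apply, LinearMap.comp_apply,
      LinearMap.compl₂_apply] at this
    change T ⁅x, y⁆ = ⁅T x, y⁆ + ⁅x, T y⁆ at this
    -- `LieDerivation` states Leibniz' rule as `⁅x, T y⁆ - ⁅y, T x⁆`.
    rw [this, ← lie_skew y (T x)]
    abel
  · change A.ricciOperator = c • LinearMap.id + T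
    rw [hT, ricciShift]
    abel

/-- The new frame is `t ε_i E_i`, with squared lengths `t²`. The signs `ε` allow models whose
structure constants differ in sign from those of `α`. -/
theorem smul_isHomotheticTo {t : ℝ} (ht : 0 < t) {β : Fin 5 → Fin 5 → Fin 5 → ℝ}
    (ε : Fin 5 → ℝ) (hε : ∀ i, ε i * ε i = 1)
    (hβ : ∀ i j k, β i j k * ε k = t * ε i * ε j * α i j k) : A.IsHomotheticTo β := by
  have hu : ∀ i, IsUnit (t * ε i) := fun i =>
    (mul_ne_zero ht.ne' (left_ne_zero_of_mul_eq_one (hε i))).isUnit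
  refine ⟨E.isUnitSMul hu, t ^ 2, by positivity, fun i j => ?_, fun i j => ?_⟩
  · simp only [Module.Basis.isUnitSMul_apply, map_smul, LinearMap.smul_apply, h.metric_eq,
      smul_eq_mul]
    split_ifs with hij
    · subst hij; linear_combination t ^ 2 * hε i
    · simp
  · simp only [Module.Basis.isUnitSMul_apply, smul_lie, lie_smul, h.lie_eq, Finset.smul_sum,
      smul_smul]
    refine Finset.sum_congr rfl fun k _ => ?_
    congr 1
    linear_combination (-t) * hβ i j k

/-- A bracket strictly raises the index, so the `n`-th term of the lower central series has no
components along the first `n` basis vectors, and the fifth term is zero. -/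
theorem isNilpotent (hα : ∀ i j k, k ≤ i ∨ k ≤ j → α i j k = 0) : LieRing.IsNilpotent A := by
  have key : ∀ n : ℕ, ∀ x ∈ LieModule.lowerCentralSeries ℝ A A n, ∀ i : Fin 5, (i : ℕ) < n →
      A.metric x (E i) = 0 := by
    intro n
    induction n with
    | zero => simp
    | succ n ih =>
      intro x hx i hi
      rw [LieModule.lowerCentralSeries_succ, ← LieSubmodule.mem_toSubmodule,
        LieSubmodule.lieIdeal_oper_eq_linear_span'] at hx
      induction hx using Submodule.span_induction with
      | zero => simp
      | add x y _ _ h1 h2 => rw [map_add, LinearMap.add_apply, h1, h2, add_zero]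
      | smul a x _ h1 => rw [map_smul, LinearMap.smul_apply, h1, smul_zero]
      | mem x hx =>
        obtain ⟨y, -, z, hz, rfl⟩ := hx
        rw [h.eq_sum_metric y, h.eq_sum_metric z]
        simp only [sum_lie, lie_sum, smul_lie, lie_smul, map_sum, map_smul, LinearMap.sum_apply,
          LinearMap.smul_apply, h.metric_lie, smul_eq_mul, Finset.mul_sum]
        refine Finset.sum_eq_zero fun a _ => Finset.sum_eq_zero fun b _ => ?_
        by_cases hib : i ≤ a ∨ i ≤ b
        · simp [hα b a i hib.symm]
        -- Here `a` indexes the components of `z`, and `a < i ≤ n`, so the induction hypothesis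
        -- kills this component.
        · have ha : (a : ℕ) < n := by omega
          simp [ih z hz _ ha]
  rw [LieRing.IsNilpotent, LieModule.isNilpotent_iff ℝ]
  refine ⟨5, (LieSubmodule.eq_bot_iff _).2 fun x hx => ?_⟩
  rw [h.eq_sum_metric x]
  exact Finset.sum_eq_zero fun i _ => by rw [key 5 x hx i i.isLt, zero_smul]

end IsOrthonormalFrame

/-- Normalizing the frame by `t = 1/√r` makes it orthonormal and multiplies the structure constants
by the same `t`. -/
theorem IsHomotheticTo.exists_frame {A : MetricLieAlgebra.{u}} {β : Fin 5 → Fin 5 → Fin 5 → ℝ}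
    (h : A.IsHomotheticTo β) :
    ∃ t : ℝ, 0 < t ∧ ∃ E : Module.Basis (Fin 5) ℝ A,
      A.IsOrthonormalFrame E (fun i j k => t * β i j k) := by
  obtain ⟨F, r, hr, h1, h2⟩ := h
  have hs : √r * √r = r := Real.mul_self_sqrt hr.le
  have hs0 : √r ≠ 0 := (Real.sqrt_pos.2 hr).ne'
  refine ⟨(√r)⁻¹, by positivity, F.isUnitSMul (fun _ => (inv_ne_zero hs0).isUnit), ?_, ?_⟩
  · intro i j
    simp only [Module.Basis.isUnitSMul_apply, map_smul, LinearMap.smul_apply, h1, smul_eq_mul]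
    split_ifs
    · rw [← mul_assoc, ← mul_inv, hs, inv_mul_cancel₀ hr.ne']
    · simp
  · intro i j
    simp only [Module.Basis.isUnitSMul_apply, smul_lie, lie_smul, h2, Finset.smul_sum, smul_smul]
    refine Finset.sum_congr rfl fun k _ => ?_
    congr 1
    ring

/-! ### One eight-parameter bracket containing every family -/

/-- The brackets `[E 0, E 1] = a E 2 + b E 3 + c E 4`, `[E 0, E 2] = d E 3 + e E 4`,
`[E 0, E 3] = f E 4`, `[E 1, E 2] = g E 4`, `[E 2, E 3] = h E 4`. -/
def triangularBracket (a b c d e f g h : ℝ) : Fin 5 → Fin 5 → Fin 5 → ℝ :=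
  ![![![0, 0, 0, 0, 0], ![0, 0, a, b, c], ![0, 0, 0, d, e], ![0, 0, 0, 0, f], ![0, 0, 0, 0, 0]],
    ![![0, 0, -a, -b, -c], ![0, 0, 0, 0, 0], ![0, 0, 0, 0, g], ![0, 0, 0, 0, 0], ![0, 0, 0, 0, 0]],
    ![![0, 0, 0, -d, -e], ![0, 0, 0, 0, -g], ![0, 0, 0, 0, 0], ![0, 0, 0, 0, h], ![0, 0, 0, 0, 0]],
    ![![0, 0, 0, 0, -f], ![0, 0, 0, 0, 0], ![0, 0, 0, 0, -h], ![0, 0, 0, 0, 0], ![0, 0, 0, 0, 0]],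
    ![![0, 0, 0, 0, 0], ![0, 0, 0, 0, 0], ![0, 0, 0, 0, 0], ![0, 0, 0, 0, 0], ![0, 0, 0, 0, 0]]]

theorem triangularBracket_eq_sum (a b c d e f g h : ℝ) : triangularBracket a b c d e f g h =
    bracketTerm 0 1 2 a + bracketTerm 0 1 3 b + bracketTerm 0 1 4 c + bracketTerm 0 2 3 d
      + bracketTerm 0 2 4 e + bracketTerm 0 3 4 f + bracketTerm 1 2 4 g + bracketTerm 2 3 4 h := by
  ext i j k
  fin_cases i <;> fin_cases j <;> fin_cases k <;> simp [triangularBracket, bracketTerm]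

theorem bracketTerm_zero (i j k : Fin 5) : bracketTerm i j k 0 = 0 := by
  ext a b c
  simp [bracketTerm]

theorem triangularBracket_eq_zero (a b c d e f g h : ℝ) (i j k : Fin 5) (hk : k ≤ i ∨ k ≤ j) :
    triangularBracket a b c d e f g h i j k = 0 := by
  revert hk
  fin_cases i <;> fin_cases j <;> fin_cases k <;> simp [triangularBracket]

theorem heis5_eq (s m : ℝ) : heis5 s m = triangularBracket 0 0 s 0 0 0 0 m := by
  simp [triangularBracket_eq_sum, bracketTerm_zero, heis5]

theorem twoStepCentre2_eq (m s : ℝ) :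
    twoStepCentre2 m s = triangularBracket 0 m 0 0 s 0 0 0 := by
  simp [triangularBracket_eq_sum, bracketTerm_zero, twoStepCentre2]

theorem twoStepCentre3_eq (m : ℝ) : twoStepCentre3 m = triangularBracket m 0 0 0 0 0 0 0 := by
  simp [triangularBracket_eq_sum, bracketTerm_zero, twoStepCentre3]

theorem l57_eq (m s u v w x : ℝ) : l57 m s u v w x = triangularBracket m s u v w x 0 0 := by
  simp [triangularBracket_eq_sum, bracketTerm_zero, l57]

theorem l56_eq (m s u v w x y : ℝ) : l56 m s u v w x y = triangularBracket m s u v w x y 0 := by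
  simp [triangularBracket_eq_sum, bracketTerm_zero, l56]

theorem l55_eq (m s u v w : ℝ) : l55 m s u v w = triangularBracket 0 m s 0 u v w 0 := by
  simp [triangularBracket_eq_sum, bracketTerm_zero, l55]

theorem l59_eq (m s u v w : ℝ) : l59 m s u v w = triangularBracket m s u v 0 0 w 0 := by
  simp [triangularBracket_eq_sum, bracketTerm_zero, l59]

/-- The components of the Ricci tensor for `triangularBracket a b c d e f g h`. -/
noncomputable def triangularRicci (a b c d e f g h : ℝ) : Fin 5 → Fin 5 → ℝ :=
  ![![-(a ^ 2 + b ^ 2 + c ^ 2 + d ^ 2 + e ^ 2 + f ^ 2) / 2, -(e * g) / 2, (c * g - f * h) / 2,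
      e * h / 2, 0],
    ![-(e * g) / 2, -(a ^ 2 + b ^ 2 + c ^ 2 + g ^ 2) / 2, -(b * d + c * e) / 2,
      (g * h - c * f) / 2, 0],
    ![(c * g - f * h) / 2, -(b * d + c * e) / 2, (a ^ 2 - d ^ 2 - e ^ 2 - g ^ 2 - h ^ 2) / 2,
      (a * b - e * f) / 2, a * c / 2],
    ![e * h / 2, (g * h - c * f) / 2, (a * b - e * f) / 2, (b ^ 2 + d ^ 2 - f ^ 2 - h ^ 2) / 2,
      (b * c + d * e) / 2],
    ![0, 0, a * c / 2, (b * c + d * e) / 2, (c ^ 2 + e ^ 2 + f ^ 2 + g ^ 2 + h ^ 2) / 2]]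

set_option maxHeartbeats 2000000 in
theorem ricciMatrix_triangularBracket (a b c d e f g h : ℝ) :
    ricciMatrix (triangularBracket a b c d e f g h) = triangularRicci a b c d e f g h := by
  ext j k
  fin_cases j <;> fin_cases k <;>
    simp [ricciMatrix, christoffel, Fin.sum_univ_five, triangularBracket, triangularRicci] <;> ring

/-- The Lie ring structure given by `triangularBracket a b c d e f g h` on the standard basis. -/
@[reducible] def triangularLieRing (a b c d e f g h : ℝ) (ha : a * h = 0) (hb : b * h = 0) :
    LieRing (ULift.{u} (Fin 5 → ℝ)) where
  bracket x y :=
    ⟨![0, 0, a * (x.down 0 * y.down 1 - x.down 1 * y.down 0),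
      b * (x.down 0 * y.down 1 - x.down 1 * y.down 0)
        + d * (x.down 0 * y.down 2 - x.down 2 * y.down 0),
      c * (x.down 0 * y.down 1 - x.down 1 * y.down 0)
        + e * (x.down 0 * y.down 2 - x.down 2 * y.down 0)
        + f * (x.down 0 * y.down 3 - x.down 3 * y.down 0)
        + g * (x.down 1 * y.down 2 - x.down 2 * y.down 1)
        + h * (x.down 2 * y.down 3 - x.down 3 * y.down 2)]⟩
  add_lie x y z := by
    refine ULift.ext _ _ (funext fun i => ?_)
    fin_cases i <;> simp <;> ring
  lie_add x y z := by
    refine ULift.ext _ _ (funext fun i => ?_)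
    fin_cases i <;> simp <;> ring
  lie_self x := by
    refine ULift.ext _ _ (funext fun i => ?_)
    fin_cases i <;> simp [mul_comm]
  leibniz_lie x y z := by
    refine ULift.ext _ _ (funext fun i => ?_)
    fin_cases i
    · simp
    · simp
    · simp
    · simp; ring
    · simp
      -- Only the last coordinate obstructs the Jacobi identity: `[E 2, [E 0, E 1]]` contributes `b
      -- h` and `[E 3, [E 0, E 1]]` contributes `-a h`.
      linear_combination
        hb * (x.down 2 * (y.down 0 * z.down 1 - y.down 1 * z.down 0)
          + y.down 2 * (z.down 0 * x.down 1 - z.down 1 * x.down 0)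
          + z.down 2 * (x.down 0 * y.down 1 - x.down 1 * y.down 0))
        - ha * (x.down 3 * (y.down 0 * z.down 1 - y.down 1 * z.down 0)
          + y.down 3 * (z.down 0 * x.down 1 - z.down 1 * x.down 0)
          + z.down 3 * (x.down 0 * y.down 1 - x.down 1 * y.down 0))

/-- The metric Lie algebra in which the standard basis is orthonormal and has structure constants
`triangularBracket a b c d e f g h`. -/
def ofTriangular (a b c d e f g h : ℝ) (ha : a * h = 0) (hb : b * h = 0) :
    MetricLieAlgebra.{u} :=
  letI := triangularLieRing.{u} a b c d e f g h ha hb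
  { carrier := ULift.{u} (Fin 5 → ℝ)
    lieRing := triangularLieRing.{u} a b c d e f g h ha hb
    lieAlgebra :=
      { lie_smul := by
          intro t x y
          refine ULift.ext _ _ (funext fun i => ?_)
          fin_cases i <;> simp [Bracket.bracket] <;> ring }
    finite := Module.Finite.equiv (ULift.moduleEquiv (R := ℝ) (M := Fin 5 → ℝ)).symm
    metric := LinearMap.mk₂ ℝ (fun x y => ∑ i, x.down i * y.down i)
      (fun x x' y => by simp [add_mul, Finset.sum_add_distrib])
      (fun t x y => by simp [mul_assoc, Finset.mul_sum])
      (fun x y y' => by simp [mul_add, Finset.sum_add_distrib])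
      (fun t x y => by simp [mul_left_comm, Finset.mul_sum])
    metric_symm := fun x y => by simp [mul_comm]
    metric_pos := fun x hx => by
      have hx' : ∃ i, x.down i ≠ 0 := by
        by_contra! hc
        exact hx (ULift.ext _ _ (funext hc))
      obtain ⟨i, hi⟩ := hx'
      simp only [LinearMap.mk₂_apply]
      exact Finset.sum_pos' (fun j _ => mul_self_nonneg _)
        ⟨i, Finset.mem_univ i, mul_self_pos.2 hi⟩ }

theorem exists_hasStructureConstants_triangularBracket (a b c d e f g h : ℝ) (ha : a * h = 0)
    (hb : b * h = 0) : ∃ A : MetricLieAlgebra.{u},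
      A.HasStructureConstants (triangularBracket a b c d e f g h) := by
  let E : Module.Basis (Fin 5) ℝ (ULift.{u} (Fin 5 → ℝ)) :=
    (Pi.basisFun ℝ (Fin 5)).map ULift.moduleEquiv.symm
  have hE : ∀ i j, (E i).down j = if j = i then 1 else 0 := fun i j => by
    change (Pi.basisFun ℝ (Fin 5) i) j = _
    simp [Pi.single_apply]
  refine ⟨ofTriangular a b c d e f g h ha hb, E, fun i j => ?_, fun i j => ?_⟩
  · change ∑ k, (E i).down k * (E j).down k = _
    simp [hE, eq_comm]
  · have hsum : ∀ v : Fin 5 → ℝ, ∑ k, v k • E k = ULift.up v := fun v => by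
      refine ULift.ext _ _ (funext fun l => ?_)
      fin_cases l <;> simp [Fin.sum_univ_five, hE]
    refine Eq.trans ?_ (hsum _).symm
    refine ULift.ext _ _ (funext fun k => ?_)
    change (![0, 0, a * ((E i).down 0 * (E j).down 1 - (E i).down 1 * (E j).down 0),
      b * ((E i).down 0 * (E j).down 1 - (E i).down 1 * (E j).down 0)
        + d * ((E i).down 0 * (E j).down 2 - (E i).down 2 * (E j).down 0),
      c * ((E i).down 0 * (E j).down 1 - (E i).down 1 * (E j).down 0)
        + e * ((E i).down 0 * (E j).down 2 - (E i).down 2 * (E j).down 0)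
        + f * ((E i).down 0 * (E j).down 3 - (E i).down 3 * (E j).down 0)
        + g * ((E i).down 1 * (E j).down 2 - (E i).down 2 * (E j).down 1)
        + h * ((E i).down 2 * (E j).down 3 - (E i).down 3 * (E j).down 2)] : Fin 5 → ℝ) k = _
    simp only [hE]
    fin_cases i <;> fin_cases j <;> fin_cases k <;> simp [triangularBracket]

/-! ### The soliton system, for diagonal Ricci tensor and for the eight-parameter bracket -/

namespace IsOrthonormalFrame

variable {A : MetricLieAlgebra.{u}} {E : Module.Basis (Fin 5) ℝ A}

section Diagonal

variable {α : Fin 5 → Fin 5 → Fin 5 → ℝ} (h : A.IsOrthonormalFrame E α)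
  (hr : ∀ i j, i ≠ j → ricciMatrix α i j = 0)
include h hr

theorem ricciOperator_eq_of_diagonal (i : Fin 5) :
    A.ricciOperator (E i) = ricciMatrix α i i • E i := by
  rw [h.ricciOperator_eq, Finset.sum_eq_single i (fun j _ hj => by rw [hr i j hj.symm, zero_smul])
    (by simp)]

theorem isDiagonal {c : ℝ} {D : LieDerivation ℝ A A} (hD : A.SolitonEquation c D)
    {d : Fin 5 → ℝ} (hd : ∀ i, d i = ricciMatrix α i i - c) : A.IsDiagonal E D d := by
  intro i
  rw [h.derivation_eq hD, ← h.ricciOperator_eq, h.ricciOperator_eq_of_diagonal hr, hd, sub_smul]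

/-- A diagonal map is a derivation when its eigenvalues add along every nonzero structure constant;
for `Ric - c Id` this is `r_k - c = (r_i - c) + (r_j - c)`. -/
theorem exists_solitonEquation_of_diagonal {c : ℝ} (hc : ∀ i j k,
    α i j k * (c + ricciMatrix α k k - ricciMatrix α i i - ricciMatrix α j j) = 0) :
    ∃ D : LieDerivation ℝ A A, A.SolitonEquation c D := by
  refine h.exists_solitonEquation fun i j k => ?_
  rw [solitonDefect, Finset.sum_sub_distrib, Finset.sum_sub_distrib,
    Finset.sum_eq_single k (fun l _ hl => by rw [hr l k hl, mul_zero]) (by simp),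
    Finset.sum_eq_single i (fun l _ hl => by rw [hr i l hl.symm, zero_mul]) (by simp),
    Finset.sum_eq_single j (fun l _ hl => by rw [hr j l hl.symm, zero_mul]) (by simp),
    ← hc i j k]
  ring

theorem trace_ricciOperator_pow (n : ℕ) :
    LinearMap.trace ℝ A (A.ricciOperator ^ n) = ∑ i, ricciMatrix α i i ^ n := by
  have hpow : ∀ i, (A.ricciOperator ^ n) (E i) = ricciMatrix α i i ^ n • E i := by
    intro i
    induction n with
    | zero => simp
    | succ n ih =>
      rw [pow_succ', Module.End.mul_apply, ih, map_smul, h.ricciOperator_eq_of_diagonal hr,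
        smul_smul, pow_succ]
  rw [LinearMap.trace_eq_matrix_trace ℝ E, Matrix.trace]
  refine Finset.sum_congr rfl fun i _ => ?_
  rw [Matrix.diag_apply, LinearMap.toMatrix_apply, hpow]
  simp

end Diagonal

section Triangular

variable {a b c d e f g h : ℝ} (hE : A.IsOrthonormalFrame E (triangularBracket a b c d e f g h))
include hE

theorem isNilpotent_of_triangular : LieRing.IsNilpotent A :=
  hE.isNilpotent (triangularBracket_eq_zero a b c d e f g h)

/-- Twelve components of the defect, with denominators cleared. The four without `C` have indices
where the bracket vanishes; they make the superfluous parameters zero. The other eight are attached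
to the eight structure constants and determine `C` and the squares. -/
theorem soliton_conditions {C : ℝ} {D : LieDerivation ℝ A A} (hD : A.SolitonEquation C D) :
    a * c * g - a * f * h + b * e * h = 0 ∧
    -a * b * d - a * c * e - b * c * f + b * g * h = 0 ∧
    a * (2 * C + 3 * a ^ 2 + 3 * b ^ 2 + 3 * c ^ 2 + f ^ 2 - h ^ 2) - b * e * f = 0 ∧
    b * (2 * C + 3 * a ^ 2 + 3 * b ^ 2 + 3 * c ^ 2 + 3 * d ^ 2 + e ^ 2 + g ^ 2 - h ^ 2)
      - a * e * f + 2 * c * d * e = 0 ∧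
    c * (2 * C + 3 * a ^ 2 + 3 * b ^ 2 + 3 * c ^ 2 + d ^ 2 + 3 * e ^ 2 + 3 * f ^ 2 + 3 * g ^ 2
      + h ^ 2) + 2 * b * d * e - 2 * f * g * h = 0 ∧
    -c * d * f + d * g * h = 0 ∧
    d * (2 * C + 3 * b ^ 2 + c ^ 2 + 3 * d ^ 2 + 3 * e ^ 2 + g ^ 2) + 2 * b * c * e = 0 ∧
    e * (2 * C + b ^ 2 + 3 * c ^ 2 + 3 * d ^ 2 + 3 * e ^ 2 + 3 * f ^ 2 + 3 * g ^ 2 + 3 * h ^ 2)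
      - a * b * f + 2 * b * c * d = 0 ∧
    -a * b * d + 2 * b * c * f - b * g * h + 2 * d * e * f = 0 ∧
    f * (2 * C + a ^ 2 + 3 * c ^ 2 + 3 * e ^ 2 + 3 * f ^ 2 + g ^ 2 + 3 * h ^ 2)
      - a * b * e - 2 * c * g * h = 0 ∧
    g * (2 * C + b ^ 2 + 3 * c ^ 2 + d ^ 2 + 3 * e ^ 2 + f ^ 2 + 3 * g ^ 2 + 3 * h ^ 2)
      - 2 * c * f * h = 0 ∧
    h * (2 * C - a ^ 2 - b ^ 2 + c ^ 2 + 3 * e ^ 2 + 3 * f ^ 2 + 3 * g ^ 2 + 3 * h ^ 2)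
      - 2 * c * f * g = 0 := by
  have key := hE.solitonDefect_eq_zero hD
  simp only [solitonDefect, ricciMatrix_triangularBracket] at key
  have e010 := key 0 1 0
  have e011 := key 0 1 1
  have e012 := key 0 1 2
  have e013 := key 0 1 3
  have e014 := key 0 1 4
  have e021 := key 0 2 1
  have e023 := key 0 2 3
  have e024 := key 0 2 4
  have e033 := key 0 3 3
  have e034 := key 0 3 4
  have e124 := key 1 2 4
  have e234 := key 2 3 4
  clear key
  simp [Fin.sum_univ_five, triangularBracket, triangularRicci]
    at e010 e011 e012 e013 e014 e021 e023 e024 e033 e034 e124 e234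
  exact ⟨by linear_combination 2 * e010, by linear_combination 2 * e011,
    by linear_combination 2 * e012, by linear_combination 2 * e013,
    by linear_combination 2 * e014, by
      -- This component has the factor `d`, which `simp` has split off as a separate alternative.
      rcases e021 with h0 | h0
      · rw [h0]; ring
      · linear_combination d * h0,
    by linear_combination 2 * e023, by linear_combination 2 * e024,
    by linear_combination 2 * e033, by linear_combination 2 * e034,
    by linear_combination 2 * e124, by linear_combination 2 * e234⟩

/-- With Ricci diagonal only one equation per structure constant remains. The coefficients of the
squares are the inner products of the weights `e_k - e_i - e_j`, for instance `3` on the diagonal.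
-/
theorem isNilsoliton_of_conditions (C : ℝ)
    (hr : ∀ i j, i ≠ j → triangularRicci a b c d e f g h i j = 0)
    (ha : a * (2 * C + 3 * a ^ 2 + 2 * b ^ 2 + 2 * c ^ 2 + f ^ 2 - h ^ 2) = 0)
    (hb : b * (2 * C + 2 * a ^ 2 + 3 * b ^ 2 + 2 * c ^ 2 + 2 * d ^ 2 + e ^ 2 + g ^ 2 - h ^ 2) = 0)
    (hc : c * (2 * C + 2 * a ^ 2 + 2 * b ^ 2 + 3 * c ^ 2 + d ^ 2 + 2 * e ^ 2 + 2 * f ^ 2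
      + 2 * g ^ 2 + h ^ 2) = 0)
    (hd : d * (2 * C + 2 * b ^ 2 + c ^ 2 + 3 * d ^ 2 + 2 * e ^ 2 + g ^ 2) = 0)
    (he : e * (2 * C + b ^ 2 + 2 * c ^ 2 + 2 * d ^ 2 + 3 * e ^ 2 + 2 * f ^ 2 + 2 * g ^ 2
      + 2 * h ^ 2) = 0)
    (hf : f * (2 * C + a ^ 2 + 2 * c ^ 2 + 2 * e ^ 2 + 3 * f ^ 2 + g ^ 2 + 2 * h ^ 2) = 0)
    (hg : g * (2 * C + b ^ 2 + 2 * c ^ 2 + d ^ 2 + 2 * e ^ 2 + f ^ 2 + 3 * g ^ 2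
      + 2 * h ^ 2) = 0)
    (hh : h * (2 * C - a ^ 2 - b ^ 2 + c ^ 2 + 2 * e ^ 2 + 2 * f ^ 2 + 2 * g ^ 2
      + 3 * h ^ 2) = 0) :
    A.IsNilsoliton := by
  refine ⟨hE.isNilpotent_of_triangular, C, hE.exists_solitonEquation_of_diagonal
    (fun i j hij => by rw [ricciMatrix_triangularBracket, hr i j hij]) fun i j k => ?_⟩
  rw [ricciMatrix_triangularBracket]
  fin_cases i <;> fin_cases j <;> fin_cases k <;>
    simp only [triangularBracket, triangularRicci, Fin.zero_eta, Fin.mk_one, Fin.reduceFinMk,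
      Matrix.cons_val, zero_mul]
  -- What is left are the nonzero entries of the bracket, each in both orders; the swapped order
  -- gives the negated equation.
  · linear_combination ha / 2
  · linear_combination hb / 2
  · linear_combination hc / 2
  · linear_combination hd / 2
  · linear_combination he / 2
  · linear_combination hf / 2
  · linear_combination -ha / 2
  · linear_combination -hb / 2
  · linear_combination -hc / 2
  · linear_combination hg / 2
  · linear_combination -hd / 2
  · linear_combination -he / 2
  · linear_combination -hg / 2
  · linear_combination hh / 2
  · linear_combination -hf / 2
  · linear_combination -hh / 2

theorem isDiagonal_of_triangular {C : ℝ} {D : LieDerivation ℝ A A} (hD : A.SolitonEquation C D)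
    (hr : ∀ i j, i ≠ j → triangularRicci a b c d e f g h i j = 0) {δ : Fin 5 → ℝ}
    (hδ : ∀ i, δ i = triangularRicci a b c d e f g h i i - C) : A.IsDiagonal E D δ :=
  hE.isDiagonal (fun i j hij => by rw [ricciMatrix_triangularBracket, hr i j hij]) hD
    (fun i => by rw [ricciMatrix_triangularBracket, hδ])

/-- By skew-symmetry it is enough to match the eight parameters. -/
theorem isHomotheticTo_triangular {a' b' c' d' e' f' g' h' t : ℝ} (ht : 0 < t) (ε : Fin 5 → ℝ)
    (hε : ∀ i, ε i * ε i = 1)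
    (ha : a' * ε 2 = t * ε 0 * ε 1 * a) (hb : b' * ε 3 = t * ε 0 * ε 1 * b)
    (hc : c' * ε 4 = t * ε 0 * ε 1 * c) (hd : d' * ε 3 = t * ε 0 * ε 2 * d)
    (he : e' * ε 4 = t * ε 0 * ε 2 * e) (hf : f' * ε 4 = t * ε 0 * ε 3 * f)
    (hg : g' * ε 4 = t * ε 1 * ε 2 * g) (hh : h' * ε 4 = t * ε 2 * ε 3 * h) :
    A.IsHomotheticTo (triangularBracket a' b' c' d' e' f' g' h') := by
  refine hE.smul_isHomotheticTo ht ε hε fun i j k => ?_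
  fin_cases i <;> fin_cases j <;> fin_cases k <;>
    simp only [triangularBracket, Fin.zero_eta, Fin.mk_one, Fin.reduceFinMk,
      Matrix.cons_val, zero_mul, mul_zero]
  · exact ha
  · exact hb
  · exact hc
  · exact hd
  · exact he
  · exact hf
  · linear_combination -ha
  · linear_combination -hb
  · linear_combination -hc
  · exact hg
  · linear_combination -hd
  · linear_combination -he
  · linear_combination -hg
  · exact hh
  · linear_combination -hf
  · linear_combination -hh

end Triangular

end IsOrthonormalFrame

theorem mul_triangularBracket (t a b c d e f g h : ℝ) :
    (fun i j k => t * triangularBracket a b c d e f g h i j k) =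
      triangularBracket (t * a) (t * b) (t * c) (t * d) (t * e) (t * f) (t * g) (t * h) := by
  ext i j k
  fin_cases i <;> fin_cases j <;> fin_cases k <;> simp [triangularBracket]

theorem sqrt_three_half_sq (x : ℝ) : (√(3 / 2) * x) ^ 2 = 3 / 2 * x ^ 2 := by
  rw [mul_pow, Real.sq_sqrt (by norm_num)]

theorem two_div_sqrt_three_mul_sq (m : ℝ) : (2 / √3 * m) ^ 2 = 4 / 3 * m ^ 2 := by
  rw [mul_pow, div_pow, Real.sq_sqrt (by norm_num)]
  norm_num

theorem sqrt_two_div_two_mul_sq (m : ℝ) : (√2 / 2 * m) ^ 2 = 1 / 2 * m ^ 2 := by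
  rw [mul_pow, div_pow, Real.sq_sqrt (by norm_num)]
  norm_num

theorem sqrt_three_div_two_mul_sq (m : ℝ) : (√3 / 2 * m) ^ 2 = 3 / 4 * m ^ 2 := by
  rw [mul_pow, div_pow, Real.sq_sqrt (by norm_num)]
  norm_num

/-! ### Necessary conditions on the parameters, family by family -/

namespace IsOrthonormalFrame

variable {A : MetricLieAlgebra.{u}} {E : Module.Basis (Fin 5) ℝ A} {c m s u v w x y : ℝ}
  {D : LieDerivation ℝ A A}

theorem heis5_of_soliton (h : A.IsOrthonormalFrame E (heis5 s m)) (hm : 0 < m) (hs : m ≤ s)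
    (hD : A.SolitonEquation c D) : s = m ∧ c = -2 * m ^ 2 := by
  rw [heis5_eq] at h
  obtain ⟨-, -, -, -, e1, -, -, -, -, -, -, e2⟩ := h.soliton_conditions hD
  have hs0 : s ≠ 0 := (hm.trans_le hs).ne'
  have e1' : 2 * c + 3 * s ^ 2 + m ^ 2 = 0 := mul_left_cancel₀ hs0 (by linear_combination e1)
  have e2' : 2 * c + s ^ 2 + 3 * m ^ 2 = 0 := mul_left_cancel₀ hm.ne' (by linear_combination e2)
  -- Subtracting the equations eliminates `c` and leaves `s² = m²`; positivity then removes the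
  -- sign.
  have : s = m := (sq_eq_sq₀ (hm.le.trans hs) hm.le).1 (by linear_combination (e1' - e2') / 2)
  subst this
  exact ⟨rfl, by linear_combination e1' / 2⟩

theorem twoStepCentre2_of_soliton (h : A.IsOrthonormalFrame E (twoStepCentre2 m s)) (hs : 0 < s)
    (hm : s ≤ m) (hD : A.SolitonEquation c D) : s = m ∧ c = -2 * m ^ 2 := by
  rw [twoStepCentre2_eq] at h
  obtain ⟨-, -, -, e1, -, -, -, e2, -, -, -, -⟩ := h.soliton_conditions hD
  have hm0 : m ≠ 0 := (hs.trans_le hm).ne'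
  have e1' : 2 * c + 3 * m ^ 2 + s ^ 2 = 0 := mul_left_cancel₀ hm0 (by linear_combination e1)
  have e2' : 2 * c + m ^ 2 + 3 * s ^ 2 = 0 := mul_left_cancel₀ hs.ne' (by linear_combination e2)
  have : s = m := (sq_eq_sq₀ hs.le (hs.le.trans hm)).1 (by linear_combination (e2' - e1') / 2)
  subst this
  exact ⟨rfl, by linear_combination e1' / 2⟩

theorem twoStepCentre3_of_soliton (h : A.IsOrthonormalFrame E (twoStepCentre3 m)) (hm : 0 < m)
    (hD : A.SolitonEquation c D) : c = -(3 / 2) * m ^ 2 := by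
  rw [twoStepCentre3_eq] at h
  obtain ⟨-, -, e1, -, -, -, -, -, -, -, -, -⟩ := h.soliton_conditions hD
  have e1' : 2 * c + 3 * m ^ 2 = 0 := mul_left_cancel₀ hm.ne' (by linear_combination e1)
  linear_combination e1' / 2

/-- A cascade of monomial equations: `u v x = 0` gives `u = 0`, then `m s v = 0` gives `s = 0`, then
`v w x = 0` gives `w = 0`. The parameter `y` may vanish, so `l57` is covered as well. -/
theorem l56_eq_zero_of_soliton (h : A.IsOrthonormalFrame E (l56 m s u v w x y)) (hm : m ≠ 0)
    (hv : v ≠ 0) (hx : x ≠ 0) (hD : A.SolitonEquation c D) : s = 0 ∧ u = 0 ∧ w = 0 := by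
  rw [l56_eq] at h
  obtain ⟨-, e011, -, -, -, e021, -, -, e033, -, -, -⟩ := h.soliton_conditions hD
  have hu : u = 0 := by simpa [hv, hx] using e021
  subst hu
  have hs : s = 0 := by simpa [hm, hv] using e011
  subst hs
  exact ⟨rfl, rfl, by simpa [hv, hx] using e033⟩

theorem l57_eq_zero_of_soliton (h : A.IsOrthonormalFrame E (l57 m s u v w x)) (hm : m ≠ 0)
    (hv : v ≠ 0) (hx : x ≠ 0) (hD : A.SolitonEquation c D) : s = 0 ∧ u = 0 ∧ w = 0 := by
  rw [l57_eq, ← l56_eq] at h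
  exact h.l56_eq_zero_of_soliton hm hv hx hD

theorem l57_of_soliton (h : A.IsOrthonormalFrame E (l57 m s u v w x)) (hm : 0 < m)
    (hv : 0 < v) (hx : 0 < x) (hD : A.SolitonEquation c D) :
    (x = m ∧ u = 0 ∧ w = 0 ∧ s = 0 ∧ v = 2 / √3 * m) ∧ c = -2 * m ^ 2 := by
  obtain ⟨rfl, rfl, rfl⟩ := h.l57_eq_zero_of_soliton hm.ne' hv.ne' hx.ne' hD
  rw [l57_eq] at h
  obtain ⟨-, -, e1, -, -, -, e2, -, -, e3, -, -⟩ := h.soliton_conditions hD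
  have e1' : 2 * c + 3 * m ^ 2 + x ^ 2 = 0 := mul_left_cancel₀ hm.ne' (by linear_combination e1)
  have e2' : 2 * c + 3 * v ^ 2 = 0 := mul_left_cancel₀ hv.ne' (by linear_combination e2)
  have e3' : 2 * c + m ^ 2 + 3 * x ^ 2 = 0 := mul_left_cancel₀ hx.ne' (by linear_combination e3)
  have : x = m := (sq_eq_sq₀ hx.le hm.le).1 (by linear_combination (e3' - e1') / 2)
  subst this
  refine ⟨⟨rfl, rfl, rfl, rfl, (sq_eq_sq₀ hv.le (by positivity)).1 ?_⟩,
    by linear_combination e1' / 2⟩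
  rw [two_div_sqrt_three_mul_sq]
  linear_combination (e2' - e1') / 3

theorem l56_of_soliton (h : A.IsOrthonormalFrame E (l56 m s u v w x y)) (hm : m ≠ 0)
    (hv : v ≠ 0) (hx : x ≠ 0) (hy : y ≠ 0) (hD : A.SolitonEquation c D) :
    (u = 0 ∧ w = 0 ∧ s = 0 ∧ (m = √(3 / 2) * x ∨ m = -√(3 / 2) * x) ∧
      (v = √(3 / 2) * x ∨ v = -√(3 / 2) * x) ∧ (y = x ∨ y = -x)) ∧ c = -(11 / 4) * x ^ 2 := by
  obtain ⟨rfl, rfl, rfl⟩ := h.l56_eq_zero_of_soliton hm hv hx hD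
  rw [l56_eq] at h
  obtain ⟨-, -, e1, -, -, -, e2, -, -, e3, e4, -⟩ := h.soliton_conditions hD
  have e1' : 2 * c + 3 * m ^ 2 + x ^ 2 = 0 := mul_left_cancel₀ hm (by linear_combination e1)
  have e2' : 2 * c + 3 * v ^ 2 + y ^ 2 = 0 := mul_left_cancel₀ hv (by linear_combination e2)
  have e3' : 2 * c + m ^ 2 + 3 * x ^ 2 + y ^ 2 = 0 :=
    mul_left_cancel₀ hx (by linear_combination e3)
  have e4' : 2 * c + v ^ 2 + x ^ 2 + 3 * y ^ 2 = 0 :=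
    mul_left_cancel₀ hy (by linear_combination e4)
  -- Turning each choice of sign into an equality of squares makes the goals linear in `c`, `m²`,
  -- `v²`, `x²`, `y²`. The four equations determine all of these in terms of `x²`.
  simp only [neg_mul, ← sq_eq_sq_iff_eq_or_eq_neg, sqrt_three_half_sq]
  refine ⟨⟨trivial, trivial, trivial, ?_, ?_, ?_⟩, ?_⟩ <;> linarith

theorem l55_of_soliton (h : A.IsOrthonormalFrame E (l55 m s u v w)) (hm : 0 < m)
    (hv : 0 < v) (hw : 0 < w) (hD : A.SolitonEquation c D) :
    (s = 0 ∧ u = 0 ∧ v = m ∧ w = √2 / 2 * m) ∧ c = -(7 / 4) * m ^ 2 := by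
  rw [l55_eq] at h
  obtain ⟨-, e011, e012, e1, -, -, -, -, -, e2, e3, -⟩ := h.soliton_conditions hD
  have hs : s = 0 := by simpa [hm.ne', hv.ne'] using e011
  have hu : u = 0 := by simpa [hm.ne', hv.ne'] using e012
  subst hs hu
  have e1' : 2 * c + 3 * m ^ 2 + w ^ 2 = 0 := mul_left_cancel₀ hm.ne' (by linear_combination e1)
  have e2' : 2 * c + 3 * v ^ 2 + w ^ 2 = 0 := mul_left_cancel₀ hv.ne' (by linear_combination e2)
  have e3' : 2 * c + m ^ 2 + v ^ 2 + 3 * w ^ 2 = 0 :=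
    mul_left_cancel₀ hw.ne' (by linear_combination e3)
  have : v = m := (sq_eq_sq₀ hv.le hm.le).1 (by linear_combination (e2' - e1') / 3)
  subst this
  refine ⟨⟨rfl, rfl, rfl, (sq_eq_sq₀ hw.le (by positivity)).1 ?_⟩, by linarith⟩
  rw [sqrt_two_div_two_mul_sq]
  linarith

/-- No order between `v` and `w` is assumed: `w = v` is a conclusion. This excludes the case `v < w`
and settles the case `w = v` at once. -/
theorem l59_of_soliton (h : A.IsOrthonormalFrame E (l59 m s u v w)) (hm : 0 < m)
    (hv : 0 < v) (hw : 0 < w) (hD : A.SolitonEquation c D) :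
    s = 0 ∧ u = 0 ∧ w = v ∧ v = √3 / 2 * m ∧ c = -(3 / 2) * m ^ 2 := by
  rw [l59_eq] at h
  obtain ⟨e010, e011, e1, -, -, -, e2, -, -, -, e3, -⟩ := h.soliton_conditions hD
  have hs : s = 0 := by simpa [hm.ne', hv.ne'] using e011
  have hu : u = 0 := by simpa [hm.ne', hw.ne'] using e010
  subst hs hu
  have e1' : 2 * c + 3 * m ^ 2 = 0 := mul_left_cancel₀ hm.ne' (by linear_combination e1)
  have e2' : 2 * c + 3 * v ^ 2 + w ^ 2 = 0 := mul_left_cancel₀ hv.ne' (by linear_combination e2)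
  have e3' : 2 * c + v ^ 2 + 3 * w ^ 2 = 0 := mul_left_cancel₀ hw.ne' (by linear_combination e3)
  have : w = v := (sq_eq_sq₀ hw.le hv.le).1 (by linear_combination (e3' - e2') / 2)
  subst this
  refine ⟨rfl, rfl, rfl, (sq_eq_sq₀ hv.le (by positivity)).1 ?_, by linarith⟩
  rw [sqrt_three_div_two_mul_sq]
  linarith

/-! ### Sufficiency: the listed parameters solve the diagonal system -/

theorem heis5_isNilsoliton (h : A.IsOrthonormalFrame E (heis5 m m)) : A.IsNilsoliton := by
  rw [heis5_eq] at h
  refine h.isNilsoliton_of_conditions (-2 * m ^ 2) ?_ ?_ ?_ ?_ ?_ ?_ ?_ ?_ ?_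
  · intro i j; fin_cases i <;> fin_cases j <;> simp [triangularRicci]
  all_goals ring

theorem twoStepCentre2_isNilsoliton (h : A.IsOrthonormalFrame E (twoStepCentre2 m m)) :
    A.IsNilsoliton := by
  rw [twoStepCentre2_eq] at h
  refine h.isNilsoliton_of_conditions (-2 * m ^ 2) ?_ ?_ ?_ ?_ ?_ ?_ ?_ ?_ ?_
  · intro i j; fin_cases i <;> fin_cases j <;> simp [triangularRicci]
  all_goals ring

theorem twoStepCentre3_isNilsoliton (h : A.IsOrthonormalFrame E (twoStepCentre3 m)) :
    A.IsNilsoliton := by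
  rw [twoStepCentre3_eq] at h
  refine h.isNilsoliton_of_conditions (-(3 / 2) * m ^ 2) ?_ ?_ ?_ ?_ ?_ ?_ ?_ ?_ ?_
  · intro i j; fin_cases i <;> fin_cases j <;> simp [triangularRicci]
  all_goals ring

/-- Only `v²` enters the system, so the hypothesis is on squares. The same form then serves both the
stated parameters and the rescaled Lauret models. -/
theorem l57_isNilsoliton (h : A.IsOrthonormalFrame E (l57 m 0 0 v 0 m))
    (hv : v ^ 2 = 4 / 3 * m ^ 2) : A.IsNilsoliton := by
  rw [l57_eq] at h
  refine h.isNilsoliton_of_conditions (-2 * m ^ 2) ?_ ?_ ?_ ?_ ?_ ?_ ?_ ?_ ?_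
  · intro i j; fin_cases i <;> fin_cases j <;> simp [triangularRicci]
  -- The equation attached to `[E 0, E 2] = v E 3`, the only one that needs the relation between `v`
  -- and `m`.
  on_goal 4 => linear_combination 3 * v * hv
  all_goals ring

theorem l56_isNilsoliton (h : A.IsOrthonormalFrame E (l56 m 0 0 v 0 x y))
    (hm : m ^ 2 = 3 / 2 * x ^ 2) (hv : v ^ 2 = 3 / 2 * x ^ 2) (hy : y ^ 2 = x ^ 2) :
    A.IsNilsoliton := by
  rw [l56_eq] at h
  refine h.isNilsoliton_of_conditions (-(11 / 4) * x ^ 2) ?_ ?_ ?_ ?_ ?_ ?_ ?_ ?_ ?_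
  · intro i j; fin_cases i <;> fin_cases j <;> simp [triangularRicci]
  · linear_combination 3 * m * hm
  · ring
  · ring
  · linear_combination 3 * v * hv + v * hy
  · ring
  · linear_combination x * hm + x * hy
  · linear_combination y * hv + 3 * y * hy
  · ring

theorem l55_isNilsoliton (h : A.IsOrthonormalFrame E (l55 m 0 0 m w))
    (hw : w ^ 2 = 1 / 2 * m ^ 2) : A.IsNilsoliton := by
  rw [l55_eq] at h
  refine h.isNilsoliton_of_conditions (-(7 / 4) * m ^ 2) ?_ ?_ ?_ ?_ ?_ ?_ ?_ ?_ ?_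
  · intro i j; fin_cases i <;> fin_cases j <;> simp [triangularRicci]
  · ring
  · linear_combination m * hw
  · ring
  · ring
  · ring
  · linear_combination m * hw
  · linear_combination 3 * w * hw
  · ring

theorem l59_isNilsoliton (h : A.IsOrthonormalFrame E (l59 m 0 0 v v))
    (hv : v ^ 2 = 3 / 4 * m ^ 2) : A.IsNilsoliton := by
  rw [l59_eq] at h
  refine h.isNilsoliton_of_conditions (-(3 / 2) * m ^ 2) ?_ ?_ ?_ ?_ ?_ ?_ ?_ ?_ ?_
  · intro i j; fin_cases i <;> fin_cases j <;> simp [triangularRicci]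
  · ring
  · ring
  · ring
  · linear_combination 4 * v * hv
  · ring
  · ring
  · linear_combination 4 * v * hv
  · ring

/-! ### The derivations, as the diagonal of `Ric - c Id` -/

theorem heis5_isDiagonal (h : A.IsOrthonormalFrame E (heis5 m m))
    (hD : A.SolitonEquation (-2 * m ^ 2) D) : A.IsDiagonal E D
      ![3 / 2 * m ^ 2, 3 / 2 * m ^ 2, 3 / 2 * m ^ 2, 3 / 2 * m ^ 2, 3 * m ^ 2] := by
  rw [heis5_eq] at h
  refine h.isDiagonal_of_triangular hD ?_ ?_
  · intro i j; fin_cases i <;> fin_cases j <;> simp [triangularRicci]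
  · intro i; fin_cases i <;> simp [triangularRicci] <;> ring

theorem twoStepCentre2_isDiagonal (h : A.IsOrthonormalFrame E (twoStepCentre2 m m))
    (hD : A.SolitonEquation (-2 * m ^ 2) D) : A.IsDiagonal E D
      ![m ^ 2, 3 / 2 * m ^ 2, 3 / 2 * m ^ 2, 5 / 2 * m ^ 2, 5 / 2 * m ^ 2] := by
  rw [twoStepCentre2_eq] at h
  refine h.isDiagonal_of_triangular hD ?_ ?_
  · intro i j; fin_cases i <;> fin_cases j <;> simp [triangularRicci]
  · intro i; fin_cases i <;> simp [triangularRicci] <;> ring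

theorem twoStepCentre3_isDiagonal (h : A.IsOrthonormalFrame E (twoStepCentre3 m))
    (hD : A.SolitonEquation (-(3 / 2) * m ^ 2) D) : A.IsDiagonal E D
      ![m ^ 2, m ^ 2, 2 * m ^ 2, 3 / 2 * m ^ 2, 3 / 2 * m ^ 2] := by
  rw [twoStepCentre3_eq] at h
  refine h.isDiagonal_of_triangular hD ?_ ?_
  · intro i j; fin_cases i <;> fin_cases j <;> simp [triangularRicci]
  · intro i; fin_cases i <;> simp [triangularRicci] <;> ring

theorem l57_isDiagonal (h : A.IsOrthonormalFrame E (l57 m 0 0 v 0 m))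
    (hv : v ^ 2 = 4 / 3 * m ^ 2) (hD : A.SolitonEquation (-2 * m ^ 2) D) : A.IsDiagonal E D
      ![1 / 3 * m ^ 2, 3 / 2 * m ^ 2, 11 / 6 * m ^ 2, 13 / 6 * m ^ 2, 5 / 2 * m ^ 2] := by
  rw [l57_eq] at h
  refine h.isDiagonal_of_triangular hD ?_ ?_
  · intro i j; fin_cases i <;> fin_cases j <;> simp [triangularRicci]
  · intro i; fin_cases i <;> simp [triangularRicci, hv] <;> ring

theorem l56_isDiagonal (h : A.IsOrthonormalFrame E (l56 m 0 0 v 0 x y))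
    (hm : m ^ 2 = 3 / 2 * x ^ 2) (hv : v ^ 2 = 3 / 2 * x ^ 2) (hy : y ^ 2 = x ^ 2)
    (hD : A.SolitonEquation (-(11 / 4) * x ^ 2) D) : A.IsDiagonal E D
      ![3 / 4 * x ^ 2, 3 / 2 * x ^ 2, 9 / 4 * x ^ 2, 3 * x ^ 2, 15 / 4 * x ^ 2] := by
  rw [l56_eq] at h
  refine h.isDiagonal_of_triangular hD ?_ ?_
  · intro i j; fin_cases i <;> fin_cases j <;> simp [triangularRicci]
  · intro i; fin_cases i <;> simp [triangularRicci, hm, hv, hy] <;> ring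

theorem l55_isDiagonal (h : A.IsOrthonormalFrame E (l55 m 0 0 m w))
    (hw : w ^ 2 = 1 / 2 * m ^ 2) (hD : A.SolitonEquation (-(7 / 4) * m ^ 2) D) :
    A.IsDiagonal E D
      ![3 / 4 * m ^ 2, m ^ 2, 3 / 2 * m ^ 2, 7 / 4 * m ^ 2, 5 / 2 * m ^ 2] := by
  rw [l55_eq] at h
  refine h.isDiagonal_of_triangular hD ?_ ?_
  · intro i j; fin_cases i <;> fin_cases j <;> simp [triangularRicci]
  · intro i; fin_cases i <;> simp [triangularRicci, hw] <;> ring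

theorem l59_isDiagonal (h : A.IsOrthonormalFrame E (l59 m 0 0 v v))
    (hv : v ^ 2 = 3 / 4 * m ^ 2) (hD : A.SolitonEquation (-(3 / 2) * m ^ 2) D) :
    A.IsDiagonal E D
      ![5 / 8 * m ^ 2, 5 / 8 * m ^ 2, 5 / 4 * m ^ 2, 15 / 8 * m ^ 2, 15 / 8 * m ^ 2] := by
  rw [l59_eq] at h
  refine h.isDiagonal_of_triangular hD ?_ ?_
  · intro i j; fin_cases i <;> fin_cases j <;> simp [triangularRicci]
  · intro i; fin_cases i <;> simp [triangularRicci, hv] <;> ring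

end IsOrthonormalFrame

/-! ### Homotheties from the nilsolitons to Lauret's models -/

theorem lauret_zero : lauret 0 = l57 √3 0 0 2 0 √3 := by
  simp [lauret, l57, bracketTerm_zero]

theorem lauret_one : lauret 1 = l56 √3 0 0 √3 0 √2 √2 := by
  simp [lauret, l56, bracketTerm_zero]

theorem lauret_two : lauret 2 = l55 √2 0 0 √2 1 := by
  simp [lauret, l55, bracketTerm_zero]

theorem lauret_three : lauret 3 = heis5 1 1 := by
  simp [lauret, heis5]

theorem lauret_four : lauret 4 = l59 2 0 0 √3 √3 := by
  simp [lauret, l59, bracketTerm_zero]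

theorem lauret_five : lauret 5 = twoStepCentre2 1 1 := by
  simp [lauret, twoStepCentre2]

theorem lauret_six : lauret 6 = twoStepCentre3 1 := by
  simp [lauret, twoStepCentre3]

variable {A : MetricLieAlgebra.{u}}

section Homothety

variable {E : Module.Basis (Fin 5) ℝ A} {m v w x y : ℝ}

theorem IsOrthonormalFrame.heis5_isHomotheticTo (h : A.IsOrthonormalFrame E (heis5 m m))
    (hm : 0 < m) : A.IsHomotheticTo (lauret 3) := by
  rw [lauret_three, heis5_eq]
  rw [heis5_eq] at h
  exact h.isHomotheticTo_triangular (inv_pos.2 hm) (fun _ => 1) (by simp)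
    (by simp) (by simp) (by simp [hm.ne']) (by simp) (by simp) (by simp) (by simp)
    (by simp [hm.ne'])

theorem IsOrthonormalFrame.twoStepCentre2_isHomotheticTo
    (h : A.IsOrthonormalFrame E (twoStepCentre2 m m)) (hm : 0 < m) :
    A.IsHomotheticTo (lauret 5) := by
  rw [lauret_five, twoStepCentre2_eq]
  rw [twoStepCentre2_eq] at h
  exact h.isHomotheticTo_triangular (inv_pos.2 hm) (fun _ => 1) (by simp)
    (by simp) (by simp [hm.ne']) (by simp) (by simp) (by simp [hm.ne']) (by simp) (by simp)
    (by simp)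

theorem IsOrthonormalFrame.twoStepCentre3_isHomotheticTo
    (h : A.IsOrthonormalFrame E (twoStepCentre3 m)) (hm : 0 < m) :
    A.IsHomotheticTo (lauret 6) := by
  rw [lauret_six, twoStepCentre3_eq]
  rw [twoStepCentre3_eq] at h
  exact h.isHomotheticTo_triangular (inv_pos.2 hm) (fun _ => 1) (by simp)
    (by simp [hm.ne']) (by simp) (by simp) (by simp) (by simp) (by simp) (by simp) (by simp)

theorem IsOrthonormalFrame.l57_isHomotheticTo
    (h : A.IsOrthonormalFrame E (l57 m 0 0 (2 / √3 * m) 0 m)) (hm : 0 < m) :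
    A.IsHomotheticTo (lauret 0) := by
  rw [lauret_zero, l57_eq]
  rw [l57_eq] at h
  have h1 : √3 = √3 / m * m := (div_mul_cancel₀ _ hm.ne').symm
  have h2 : 2 = √3 / m * (2 / √3 * m) := by field_simp
  exact h.isHomotheticTo_triangular (t := √3 / m) (by positivity) (fun _ => 1) (by simp)
    (by simpa using h1) (by simp) (by simp) (by simpa using h2) (by simp) (by simpa using h1)
    (by simp) (by simp)

theorem IsOrthonormalFrame.l55_isHomotheticTo
    (h : A.IsOrthonormalFrame E (l55 m 0 0 m (√2 / 2 * m))) (hm : 0 < m) :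
    A.IsHomotheticTo (lauret 2) := by
  rw [lauret_two, l55_eq]
  rw [l55_eq] at h
  have h1 : √2 = √2 / m * m := (div_mul_cancel₀ _ hm.ne').symm
  have h2 : 1 = √2 / m * (√2 / 2 * m) := by
    field_simp
    rw [Real.sq_sqrt (by norm_num)]
  exact h.isHomotheticTo_triangular (t := √2 / m) (by positivity) (fun _ => 1) (by simp)
    (by simp) (by simpa using h1) (by simp) (by simp) (by simp) (by simpa using h1)
    (by simpa using h2) (by simp)

theorem IsOrthonormalFrame.l59_isHomotheticTo
    (h : A.IsOrthonormalFrame E (l59 m 0 0 (√3 / 2 * m) (√3 / 2 * m))) (hm : 0 < m) :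
    A.IsHomotheticTo (lauret 4) := by
  rw [lauret_four, l59_eq]
  rw [l59_eq] at h
  have h1 : 2 = 2 / m * m := (div_mul_cancel₀ _ hm.ne').symm
  have h2 : √3 = 2 / m * (√3 / 2 * m) := by field_simp
  exact h.isHomotheticTo_triangular (t := 2 / m) (by positivity) (fun _ => 1) (by simp)
    (by simpa using h1) (by simp) (by simp) (by simpa using h2) (by simp) (by simp)
    (by simpa using h2) (by simp)

theorem exists_sign_mul_eq {p q : ℝ} (h : p = q ∨ p = -q) : ∃ σ : ℝ, σ * σ = 1 ∧ p = σ * q := by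
  rcases h with h | h
  · exact ⟨1, by simp, by simp [h]⟩
  · exact ⟨-1, by simp, by simp [h]⟩

/-- The signs of `m`, `v`, `x`, `y` are arbitrary, and all of them can be absorbed by reflecting
basis vectors. -/
theorem IsOrthonormalFrame.l56_isHomotheticTo (h : A.IsOrthonormalFrame E (l56 m 0 0 v 0 x y))
    (hx : x ≠ 0) (hm : m = √(3 / 2) * x ∨ m = -√(3 / 2) * x)
    (hv : v = √(3 / 2) * x ∨ v = -√(3 / 2) * x) (hy : y = x ∨ y = -x) :
    A.IsHomotheticTo (lauret 1) := by
  rw [neg_mul] at hm hv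
  obtain ⟨σ, hσ, rfl⟩ := exists_sign_mul_eq hm
  obtain ⟨τ, hτ, rfl⟩ := exists_sign_mul_eq hv
  obtain ⟨ρ, hρ, rfl⟩ := exists_sign_mul_eq hy
  obtain ⟨κ, hκ, hxκ⟩ := exists_sign_mul_eq (abs_choice x)
  rw [lauret_one, l56_eq]
  rw [l56_eq] at h
  have ht : √2 / |x| * x = √2 * κ := by
    have h0 : |x| ≠ 0 := abs_ne_zero.2 hx
    field_simp
    rw [hxκ]
    linear_combination -x * hκ
  have h3 : √2 * √(3 / 2) = √3 := by
    rw [← Real.sqrt_mul (by norm_num)]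
    norm_num
  -- With `ε 0 = 1` the signs must satisfy `ε 2 = κσ ε 1`, `ε 3 = κτ ε 2`, `ε 4 = κ ε 3` and `ε 4 =
  -- κρ ε 1 ε 2`. The vector is the unique solution.
  refine h.isHomotheticTo_triangular (t := √2 / |x|) (by positivity)
    ![1, ρ * τ * κ, σ * ρ * τ, σ * ρ * κ, σ * ρ] ?_ ?_ (by simp) (by simp) ?_ (by simp) ?_ ?_
    (by simp)
  · have key : ∀ p q : ℝ, p * p = 1 → q * q = 1 → p * q * (p * q) = 1 := fun p q hp hq => by
      rw [mul_mul_mul_comm, hp, hq, one_mul]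
    intro i
    fin_cases i
    · simp
    · exact key _ _ (key _ _ hρ hτ) hκ
    · exact key _ _ (key _ _ hσ hρ) hτ
    · exact key _ _ (key _ _ hσ hρ) hκ
    · exact key _ _ hσ hρ
  · simp only [Matrix.cons_val]
    linear_combination (-ρ * τ * κ * σ * √(3 / 2)) * ht - ρ * τ * σ * κ * κ * h3
      - ρ * τ * σ * √3 * hκ
  · simp only [Matrix.cons_val]
    linear_combination (-σ * ρ * τ * τ * √(3 / 2)) * ht - σ * ρ * κ * τ * τ * h3
      - σ * ρ * κ * √3 * hτ
  · simp only [Matrix.cons_val]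
    linear_combination (-σ * ρ * κ) * ht - √2 * σ * ρ * hκ
  · simp only [Matrix.cons_val]
    linear_combination (-ρ * τ * κ * σ * ρ * τ * ρ) * ht - √2 * σ * ρ * (τ * τ * κ * κ) * hρ
      - √2 * σ * ρ * κ * κ * hτ - √2 * σ * ρ * hκ

end Homothety

/-! ### From Lauret's models back to the families -/

section Converse

theorem IsHomotheticTo.exists_frame_triangular {a b c d e f g h : ℝ}
    (H : A.IsHomotheticTo (triangularBracket a b c d e f g h)) :
    ∃ t : ℝ, 0 < t ∧ ∃ E : Module.Basis (Fin 5) ℝ A, A.IsOrthonormalFrame E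
      (triangularBracket (t * a) (t * b) (t * c) (t * d) (t * e) (t * f) (t * g) (t * h)) := by
  obtain ⟨t, ht, E, hE⟩ := H.exists_frame
  rw [mul_triangularBracket] at hE
  exact ⟨t, ht, E, hE⟩

theorem IsHomotheticTo.exists_heis5 (H : A.IsHomotheticTo (lauret 3)) :
    ∃ m : ℝ, 0 < m ∧ ∃ E : Module.Basis (Fin 5) ℝ A, A.IsOrthonormalFrame E (heis5 m m) := by
  rw [lauret_three, heis5_eq] at H
  obtain ⟨t, ht, E, hE⟩ := H.exists_frame_triangular
  simp only [mul_zero, mul_one] at hE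
  exact ⟨t, ht, E, by rwa [heis5_eq]⟩

theorem IsHomotheticTo.exists_twoStepCentre2 (H : A.IsHomotheticTo (lauret 5)) :
    ∃ m : ℝ, 0 < m ∧ ∃ E : Module.Basis (Fin 5) ℝ A,
      A.IsOrthonormalFrame E (twoStepCentre2 m m) := by
  rw [lauret_five, twoStepCentre2_eq] at H
  obtain ⟨t, ht, E, hE⟩ := H.exists_frame_triangular
  simp only [mul_zero, mul_one] at hE
  exact ⟨t, ht, E, by rwa [twoStepCentre2_eq]⟩

theorem IsHomotheticTo.exists_twoStepCentre3 (H : A.IsHomotheticTo (lauret 6)) :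
    ∃ m : ℝ, 0 < m ∧ ∃ E : Module.Basis (Fin 5) ℝ A,
      A.IsOrthonormalFrame E (twoStepCentre3 m) := by
  rw [lauret_six, twoStepCentre3_eq] at H
  obtain ⟨t, ht, E, hE⟩ := H.exists_frame_triangular
  simp only [mul_zero, mul_one] at hE
  exact ⟨t, ht, E, by rwa [twoStepCentre3_eq]⟩

theorem IsHomotheticTo.exists_l57 (H : A.IsHomotheticTo (lauret 0)) :
    ∃ m v : ℝ, 0 < m ∧ 0 < v ∧ v ^ 2 = 4 / 3 * m ^ 2 ∧ ∃ E : Module.Basis (Fin 5) ℝ A,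
      A.IsOrthonormalFrame E (l57 m 0 0 v 0 m) := by
  rw [lauret_zero, l57_eq] at H
  obtain ⟨t, ht, E, hE⟩ := H.exists_frame_triangular
  simp only [mul_zero] at hE
  refine ⟨t * √3, t * 2, by positivity, by positivity, ?_, E, by rwa [l57_eq]⟩
  rw [mul_pow, mul_pow, Real.sq_sqrt (by norm_num)]
  ring

theorem IsHomotheticTo.exists_l56 (H : A.IsHomotheticTo (lauret 1)) :
    ∃ m x : ℝ, 0 < m ∧ 0 < x ∧ m ^ 2 = 3 / 2 * x ^ 2 ∧ ∃ E : Module.Basis (Fin 5) ℝ A,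
      A.IsOrthonormalFrame E (l56 m 0 0 m 0 x x) := by
  rw [lauret_one, l56_eq] at H
  obtain ⟨t, ht, E, hE⟩ := H.exists_frame_triangular
  simp only [mul_zero] at hE
  refine ⟨t * √3, t * √2, by positivity, by positivity, ?_, E, by rwa [l56_eq]⟩
  rw [mul_pow, mul_pow, Real.sq_sqrt (by norm_num), Real.sq_sqrt (by norm_num)]
  ring

theorem IsHomotheticTo.exists_l55 (H : A.IsHomotheticTo (lauret 2)) :
    ∃ m w : ℝ, 0 < m ∧ 0 < w ∧ w ^ 2 = 1 / 2 * m ^ 2 ∧ ∃ E : Module.Basis (Fin 5) ℝ A,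
      A.IsOrthonormalFrame E (l55 m 0 0 m w) := by
  rw [lauret_two, l55_eq] at H
  obtain ⟨t, ht, E, hE⟩ := H.exists_frame_triangular
  simp only [mul_zero, mul_one] at hE
  refine ⟨t * √2, t, by positivity, ht, ?_, E, by rwa [l55_eq]⟩
  rw [mul_pow, Real.sq_sqrt (by norm_num)]
  ring

theorem IsHomotheticTo.exists_l59 (H : A.IsHomotheticTo (lauret 4)) :
    ∃ m v : ℝ, 0 < m ∧ 0 < v ∧ v ^ 2 = 3 / 4 * m ^ 2 ∧ ∃ E : Module.Basis (Fin 5) ℝ A,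
      A.IsOrthonormalFrame E (l59 m 0 0 v v) := by
  rw [lauret_four, l59_eq] at H
  obtain ⟨t, ht, E, hE⟩ := H.exists_frame_triangular
  simp only [mul_zero] at hE
  refine ⟨t * 2, t * √3, by positivity, by positivity, ?_, E, by rwa [l59_eq]⟩
  rw [mul_pow, mul_pow, Real.sq_sqrt (by norm_num)]
  ring

end Converse

/-! ### Separating the seven classes by power sums of Ricci eigenvalues -/

theorem triangularRicci_mul (t a b c d e f g h : ℝ) (i j : Fin 5) :
    triangularRicci (t * a) (t * b) (t * c) (t * d) (t * e) (t * f) (t * g) (t * h) i j =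
      t ^ 2 * triangularRicci a b c d e f g h i j := by
  fin_cases i <;> fin_cases j <;> simp [triangularRicci] <;> ring

/-- Ricci is quadratic in the bracket, so a homothety multiplies its eigenvalues by a common `τ =
t²`, which does not depend on `n`. -/
theorem IsHomotheticTo.exists_trace_ricciOperator_pow {a b c d e f g h : ℝ}
    (H : A.IsHomotheticTo (triangularBracket a b c d e f g h))
    (hr : ∀ i j, i ≠ j → triangularRicci a b c d e f g h i j = 0) :
    ∃ τ : ℝ, 0 < τ ∧ ∀ n : ℕ, LinearMap.trace ℝ A (A.ricciOperator ^ n) =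
      τ ^ n * ∑ i, triangularRicci a b c d e f g h i i ^ n := by
  obtain ⟨t, ht, E, hE⟩ := H.exists_frame_triangular
  refine ⟨t ^ 2, by positivity, fun n => ?_⟩
  rw [hE.trace_ricciOperator_pow (fun i j hij => by
    rw [ricciMatrix_triangularBracket, triangularRicci_mul, hr i j hij, mul_zero]) n,
    Finset.mul_sum]
  refine Finset.sum_congr rfl fun i _ => ?_
  rw [ricciMatrix_triangularBracket, triangularRicci_mul, mul_pow]

/-- The Ricci eigenvalues of Lauret's nilsolitons. -/
noncomputable def lauretRicci : Fin 7 → Fin 5 → ℝ :=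
  ![![-5, -3 / 2, -1 / 2, 1 / 2, 3 / 2], ![-4, -5 / 2, -1, 1 / 2, 2],
    ![-2, -3 / 2, -1 / 2, 0, 3 / 2], ![-1 / 2, -1 / 2, -1 / 2, -1 / 2, 1],
    ![-7 / 2, -7 / 2, -1, 3 / 2, 3 / 2], ![-1, -1 / 2, -1 / 2, 1 / 2, 1 / 2],
    ![-1 / 2, -1 / 2, 1 / 2, 0, 0]]

theorem sum_lauretRicci (p : Fin 7) :
    ∑ i, lauretRicci p i = (![-5, -5, -5 / 2, -1, -5, -1, -1 / 2] : Fin 7 → ℝ) p := by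
  fin_cases p <;> simp [lauretRicci, Fin.sum_univ_five] <;> norm_num

theorem sum_lauretRicci_sq (p : Fin 7) : ∑ i, lauretRicci p i ^ 2 =
    (![30, 55 / 2, 35 / 4, 2, 30, 2, 3 / 4] : Fin 7 → ℝ) p := by
  fin_cases p <;> simp [lauretRicci, Fin.sum_univ_five] <;> norm_num

theorem sum_lauretRicci_cube (p : Fin 7) : ∑ i, lauretRicci p i ^ 3 =
    (![-125, -145 / 2, -65 / 8, 1 / 2, -80, -1, -1 / 8] : Fin 7 → ℝ) p := by
  fin_cases p <;> simp [lauretRicci, Fin.sum_univ_five] <;> norm_num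

theorem exists_lauret_eq_triangularBracket (p : Fin 7) : ∃ a b c d e f g h : ℝ,
    lauret p = triangularBracket a b c d e f g h ∧
    ∀ i j, triangularRicci a b c d e f g h i j = if i = j then lauretRicci p i else 0 := by
  fin_cases p
  · refine ⟨_, _, _, _, _, _, _, _, lauret_zero.trans (l57_eq ..), fun i j => ?_⟩
    fin_cases i <;> fin_cases j <;> simp [triangularRicci, lauretRicci] <;> norm_num
  · refine ⟨_, _, _, _, _, _, _, _, lauret_one.trans (l56_eq ..), fun i j => ?_⟩
    fin_cases i <;> fin_cases j <;> simp [triangularRicci, lauretRicci] <;> norm_num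
  · refine ⟨_, _, _, _, _, _, _, _, lauret_two.trans (l55_eq ..), fun i j => ?_⟩
    fin_cases i <;> fin_cases j <;> simp [triangularRicci, lauretRicci] <;> norm_num
  · refine ⟨_, _, _, _, _, _, _, _, lauret_three.trans (heis5_eq ..), fun i j => ?_⟩
    fin_cases i <;> fin_cases j <;> simp [triangularRicci, lauretRicci]
  · refine ⟨_, _, _, _, _, _, _, _, lauret_four.trans (l59_eq ..), fun i j => ?_⟩
    fin_cases i <;> fin_cases j <;> simp [triangularRicci, lauretRicci] <;> norm_num
  · refine ⟨_, _, _, _, _, _, _, _, lauret_five.trans (twoStepCentre2_eq ..), fun i j => ?_⟩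
    fin_cases i <;> fin_cases j <;> simp [triangularRicci, lauretRicci]
  · refine ⟨_, _, _, _, _, _, _, _, lauret_six.trans (twoStepCentre3_eq ..), fun i j => ?_⟩
    fin_cases i <;> fin_cases j <;> simp [triangularRicci, lauretRicci]

theorem IsHomotheticTo.exists_trace_lauret {p : Fin 7} (H : A.IsHomotheticTo (lauret p)) :
    ∃ τ : ℝ, 0 < τ ∧ ∀ n : ℕ, LinearMap.trace ℝ A (A.ricciOperator ^ n) =
      τ ^ n * ∑ i, lauretRicci p i ^ n := by
  obtain ⟨a, b, c, d, e, f, g, h, hp, hr⟩ := exists_lauret_eq_triangularBracket p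
  rw [hp] at H
  obtain ⟨τ, hτ, hn⟩ := H.exists_trace_ricciOperator_pow fun i j hij => by rw [hr, if_neg hij]
  exact ⟨τ, hτ, fun n => by simp only [hn, hr, if_true]⟩

/-- The ratio `tr Ric^n / (tr Ric)^n` does not see the scale; it is compared here in
cross-multiplied form. -/
theorem IsHomotheticTo.power_sums_eq {p q : Fin 7} (hp : A.IsHomotheticTo (lauret p))
    (hq : A.IsHomotheticTo (lauret q)) (n : ℕ) :
    (∑ i, lauretRicci p i ^ n) * (∑ i, lauretRicci q i) ^ n =
      (∑ i, lauretRicci q i ^ n) * (∑ i, lauretRicci p i) ^ n := by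
  obtain ⟨τ, hτ, ht⟩ := hp.exists_trace_lauret
  obtain ⟨σ, hσ, hs⟩ := hq.exists_trace_lauret
  have h1 := (ht 1).symm.trans (hs 1)
  have hn := (ht n).symm.trans (hs n)
  simp only [pow_one] at h1
  have h2 := congrArg (· ^ n) h1
  simp only [mul_pow] at h2
  -- `hn` and `h2` equate the `n`-th power sums and the `n`-th powers of the traces, each up to
  -- `τ^n` and `σ^n`; multiplying them crosswise produces this common factor.
  have h0 : τ ^ n * σ ^ n ≠ 0 := by positivity
  refine mul_left_cancel₀ h0 ?_
  linear_combination (σ ^ n * (∑ i, lauretRicci q i) ^ n) * hn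
    - (σ ^ n * ∑ i, lauretRicci q i ^ n) * h2

theorem IsHomotheticTo.lauret_injective {p q : Fin 7} (hp : A.IsHomotheticTo (lauret p))
    (hq : A.IsHomotheticTo (lauret q)) : p = q := by
  have h2 := hp.power_sums_eq hq 2
  have h3 := hp.power_sums_eq hq 3
  clear hp hq
  rw [sum_lauretRicci, sum_lauretRicci, sum_lauretRicci_sq, sum_lauretRicci_sq] at h2
  rw [sum_lauretRicci, sum_lauretRicci, sum_lauretRicci_cube, sum_lauretRicci_cube] at h3
  -- The ratios for `n = 2` are `6/5, 11/10, 7/5, 2, 6/5, 2, 3`. The two coincidences, indices `0,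
  -- 4` and `3, 5`, are resolved by `n = 3`, with ratios `1, 16/25` and `-1/2, 1`.
  fin_cases p <;> fin_cases q <;> first
    | rfl
    | (exfalso
       simp only [Fin.zero_eta, Fin.mk_one, Fin.reduceFinMk, Matrix.cons_val] at h2 h3
       first
         | (norm_num at h2; done)
         | norm_num at h3)

end MetricLieAlgebra

/-! ### Assembly of the classification -/

open MetricLieAlgebra in
theorem mainTheorem1 :
    -- Two-step, one-dimensional centre
    (∀ s m : ℝ, 0 < m → m ≤ s →
      (∃ A : MetricLieAlgebra.{u}, A.HasStructureConstants (heis5 s m)) ∧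
      ∀ (A : MetricLieAlgebra.{u}) (E : Module.Basis (Fin 5) ℝ A),
        A.IsOrthonormalFrame E (heis5 s m) →
        LieRing.IsNilpotent A ∧
        (A.IsNilsoliton ↔ s = m) ∧
        ∀ (c : ℝ) (D : LieDerivation ℝ A A), A.SolitonEquation c D →
          c = -2 * m ^ 2 ∧
          A.IsDiagonal E D
            ![3 / 2 * m ^ 2, 3 / 2 * m ^ 2, 3 / 2 * m ^ 2, 3 / 2 * m ^ 2, 3 * m ^ 2]) ∧
    -- Two-step, two-dimensional centre
    (∀ m s : ℝ, 0 < s → s ≤ m →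
      (∃ A : MetricLieAlgebra.{u}, A.HasStructureConstants (twoStepCentre2 m s)) ∧
      ∀ (A : MetricLieAlgebra.{u}) (E : Module.Basis (Fin 5) ℝ A),
        A.IsOrthonormalFrame E (twoStepCentre2 m s) →
        LieRing.IsNilpotent A ∧
        (A.IsNilsoliton ↔ s = m) ∧
        ∀ (c : ℝ) (D : LieDerivation ℝ A A), A.SolitonEquation c D →
          c = -2 * m ^ 2 ∧
          A.IsDiagonal E D
            ![m ^ 2, 3 / 2 * m ^ 2, 3 / 2 * m ^ 2, 5 / 2 * m ^ 2, 5 / 2 * m ^ 2]) ∧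
    -- Two-step, three-dimensional centre
    (∀ m : ℝ, 0 < m →
      (∃ A : MetricLieAlgebra.{u}, A.HasStructureConstants (twoStepCentre3 m)) ∧
      ∀ (A : MetricLieAlgebra.{u}) (E : Module.Basis (Fin 5) ℝ A),
        A.IsOrthonormalFrame E (twoStepCentre3 m) →
        LieRing.IsNilpotent A ∧
        A.IsNilsoliton ∧
        ∀ (c : ℝ) (D : LieDerivation ℝ A A), A.SolitonEquation c D →
          c = -(3 / 2) * m ^ 2 ∧
          A.IsDiagonal E D ![m ^ 2, m ^ 2, 2 * m ^ 2, 3 / 2 * m ^ 2, 3 / 2 * m ^ 2]) ∧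
    -- `𝔩_{5,7}`, case A
    (∀ m s u v w x : ℝ, 0 < m → 0 < v → 0 < x → s = 0 → 0 ≤ w →
      (∃ A : MetricLieAlgebra.{u}, A.HasStructureConstants (l57 m s u v w x)) ∧
      ∀ (A : MetricLieAlgebra.{u}) (E : Module.Basis (Fin 5) ℝ A),
        A.IsOrthonormalFrame E (l57 m s u v w x) →
        LieRing.IsNilpotent A ∧
        (A.IsNilsoliton ↔ x = m ∧ u = 0 ∧ w = 0 ∧ s = 0 ∧ v = 2 / √3 * m) ∧
        ∀ (c : ℝ) (D : LieDerivation ℝ A A), A.SolitonEquation c D →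
          c = -2 * m ^ 2 ∧
          A.IsDiagonal E D
            ![1 / 3 * m ^ 2, 3 / 2 * m ^ 2, 11 / 6 * m ^ 2, 13 / 6 * m ^ 2, 5 / 2 * m ^ 2]) ∧
    -- `𝔩_{5,7}`, case B
    (∀ m s u v w x : ℝ, 0 < m → 0 < v → 0 < x → 0 < s →
      (∃ A : MetricLieAlgebra.{u}, A.HasStructureConstants (l57 m s u v w x)) ∧
      ∀ A : MetricLieAlgebra.{u}, A.HasStructureConstants (l57 m s u v w x) →
        LieRing.IsNilpotent A ∧ ¬ A.IsNilsoliton) ∧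
    -- `𝔩_{5,6}`, case A
    (∀ m s u v w x y : ℝ, m ≠ 0 → v ≠ 0 → x ≠ 0 → y ≠ 0 → s = 0 → 0 ≤ w →
      (∃ A : MetricLieAlgebra.{u}, A.HasStructureConstants (l56 m s u v w x y)) ∧
      ∀ (A : MetricLieAlgebra.{u}) (E : Module.Basis (Fin 5) ℝ A),
        A.IsOrthonormalFrame E (l56 m s u v w x y) →
        LieRing.IsNilpotent A ∧
        (A.IsNilsoliton ↔ u = 0 ∧ w = 0 ∧ s = 0 ∧
          (m = √(3 / 2) * x ∨ m = -√(3 / 2) * x) ∧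
          (v = √(3 / 2) * x ∨ v = -√(3 / 2) * x) ∧ (y = x ∨ y = -x)) ∧
        ∀ (c : ℝ) (D : LieDerivation ℝ A A), A.SolitonEquation c D →
          c = -(11 / 4) * x ^ 2 ∧
          A.IsDiagonal E D
            ![3 / 4 * x ^ 2, 3 / 2 * x ^ 2, 9 / 4 * x ^ 2, 3 * x ^ 2, 15 / 4 * x ^ 2]) ∧
    -- `𝔩_{5,6}`, case B
    (∀ m s u v w x y : ℝ, m ≠ 0 → v ≠ 0 → x ≠ 0 → y ≠ 0 → 0 < s →
      (∃ A : MetricLieAlgebra.{u}, A.HasStructureConstants (l56 m s u v w x y)) ∧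
      ∀ A : MetricLieAlgebra.{u}, A.HasStructureConstants (l56 m s u v w x y) →
        LieRing.IsNilpotent A ∧ ¬ A.IsNilsoliton) ∧
    -- `𝔩_{5,5}`
    (∀ m s u v w : ℝ, 0 ≤ s → 0 ≤ u → 0 < m → 0 < v → 0 < w →
      (∃ A : MetricLieAlgebra.{u}, A.HasStructureConstants (l55 m s u v w)) ∧
      ∀ (A : MetricLieAlgebra.{u}) (E : Module.Basis (Fin 5) ℝ A),
        A.IsOrthonormalFrame E (l55 m s u v w) →
        LieRing.IsNilpotent A ∧
        (A.IsNilsoliton ↔ s = 0 ∧ u = 0 ∧ v = m ∧ w = √2 / 2 * m) ∧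
        ∀ (c : ℝ) (D : LieDerivation ℝ A A), A.SolitonEquation c D →
          c = -(7 / 4) * m ^ 2 ∧
          A.IsDiagonal E D
            ![3 / 4 * m ^ 2, m ^ 2, 3 / 2 * m ^ 2, 7 / 4 * m ^ 2, 5 / 2 * m ^ 2]) ∧
    -- `𝔩_{5,9}`, case A
    (∀ m s u v w : ℝ, 0 < m → 0 < v → v < w → 0 ≤ s → 0 ≤ u →
      (∃ A : MetricLieAlgebra.{u}, A.HasStructureConstants (l59 m s u v w)) ∧
      ∀ A : MetricLieAlgebra.{u}, A.HasStructureConstants (l59 m s u v w) →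
        LieRing.IsNilpotent A ∧ ¬ A.IsNilsoliton) ∧
    -- `𝔩_{5,9}`, case B
    (∀ m s u v w : ℝ, 0 < m → 0 < v → w = v → 0 ≤ s → u = 0 →
      (∃ A : MetricLieAlgebra.{u}, A.HasStructureConstants (l59 m s u v w)) ∧
      ∀ (A : MetricLieAlgebra.{u}) (E : Module.Basis (Fin 5) ℝ A),
        A.IsOrthonormalFrame E (l59 m s u v w) →
        LieRing.IsNilpotent A ∧
        (A.IsNilsoliton ↔ s = 0 ∧ v = √3 / 2 * m) ∧
        ∀ (c : ℝ) (D : LieDerivation ℝ A A), A.SolitonEquation c D →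
          c = -(3 / 2) * m ^ 2 ∧
          A.IsDiagonal E D
            ![5 / 8 * m ^ 2, 5 / 8 * m ^ 2, 5 / 4 * m ^ 2, 15 / 8 * m ^ 2, 15 / 8 * m ^ 2]) ∧
    -- The nilsolitons of the seven families are, up to isometry and scaling, Lauret's `μ'₁, …, μ'₇`
    (∀ A : MetricLieAlgebra.{u},
      ((A.IsNilsoliton ∧ ∃ s m : ℝ, 0 < m ∧ m ≤ s ∧ A.HasStructureConstants (heis5 s m)) ↔
        A.IsHomotheticTo (lauret 3)) ∧
      ((A.IsNilsoliton ∧ ∃ m s : ℝ, 0 < s ∧ s ≤ m ∧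
          A.HasStructureConstants (twoStepCentre2 m s)) ↔
        A.IsHomotheticTo (lauret 5)) ∧
      ((A.IsNilsoliton ∧ ∃ m : ℝ, 0 < m ∧ A.HasStructureConstants (twoStepCentre3 m)) ↔
        A.IsHomotheticTo (lauret 6)) ∧
      ((A.IsNilsoliton ∧ ∃ m s u v w x : ℝ, 0 < m ∧ 0 < v ∧ 0 < x ∧ s = 0 ∧ 0 ≤ w ∧
          A.HasStructureConstants (l57 m s u v w x)) ↔
        A.IsHomotheticTo (lauret 0)) ∧
      ((A.IsNilsoliton ∧ ∃ m s u v w x y : ℝ, m ≠ 0 ∧ v ≠ 0 ∧ x ≠ 0 ∧ y ≠ 0 ∧ s = 0 ∧ 0 ≤ w ∧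
          A.HasStructureConstants (l56 m s u v w x y)) ↔
        A.IsHomotheticTo (lauret 1)) ∧
      ((A.IsNilsoliton ∧ ∃ m s u v w : ℝ, 0 ≤ s ∧ 0 ≤ u ∧ 0 < m ∧ 0 < v ∧ 0 < w ∧
          A.HasStructureConstants (l55 m s u v w)) ↔
        A.IsHomotheticTo (lauret 2)) ∧
      ((A.IsNilsoliton ∧ ∃ m s u v w : ℝ, 0 < m ∧ 0 < v ∧ w = v ∧ 0 ≤ s ∧ u = 0 ∧
          A.HasStructureConstants (l59 m s u v w)) ↔
        A.IsHomotheticTo (lauret 4)) ∧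
      ∀ i j : Fin 7, A.IsHomotheticTo (lauret i) → A.IsHomotheticTo (lauret j) → i = j) := by
  refine ⟨?_, ?_, ?_, ?_, ?_, ?_, ?_, ?_, ?_, ?_, ?_⟩
  · intro s m hm hs
    refine ⟨?_, fun A E h => ?_⟩
    · rw [heis5_eq]
      exact exists_hasStructureConstants_triangularBracket _ _ _ _ _ _ _ _ (by simp) (by simp)
    refine ⟨(heis5_eq s m ▸ h).isNilpotent_of_triangular, ⟨fun ⟨_, c, D, hD⟩ =>
      (h.heis5_of_soliton hm hs hD).1, fun hsm => ?_⟩, fun c D hD => ?_⟩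
    · subst hsm
      exact h.heis5_isNilsoliton
    · obtain ⟨rfl, rfl⟩ := h.heis5_of_soliton hm hs hD
      exact ⟨rfl, h.heis5_isDiagonal hD⟩
  · intro m s hs hm
    refine ⟨?_, fun A E h => ?_⟩
    · rw [twoStepCentre2_eq]
      exact exists_hasStructureConstants_triangularBracket _ _ _ _ _ _ _ _ (by simp) (by simp)
    refine ⟨(twoStepCentre2_eq m s ▸ h).isNilpotent_of_triangular, ⟨fun ⟨_, c, D, hD⟩ =>
      (h.twoStepCentre2_of_soliton hs hm hD).1, fun hsm => ?_⟩, fun c D hD => ?_⟩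
    · subst hsm
      exact h.twoStepCentre2_isNilsoliton
    · obtain ⟨rfl, rfl⟩ := h.twoStepCentre2_of_soliton hs hm hD
      exact ⟨rfl, h.twoStepCentre2_isDiagonal hD⟩
  · intro m hm
    refine ⟨?_, fun A E h => ?_⟩
    · rw [twoStepCentre3_eq]
      exact exists_hasStructureConstants_triangularBracket _ _ _ _ _ _ _ _ (by simp) (by simp)
    refine ⟨(twoStepCentre3_eq m ▸ h).isNilpotent_of_triangular, h.twoStepCentre3_isNilsoliton,
      fun c D hD => ?_⟩
    obtain rfl := h.twoStepCentre3_of_soliton hm hD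
    exact ⟨rfl, h.twoStepCentre3_isDiagonal hD⟩
  · intro m s u v w x hm hv hx _ _
    refine ⟨?_, fun A E h => ?_⟩
    · rw [l57_eq]
      exact exists_hasStructureConstants_triangularBracket _ _ _ _ _ _ _ _ (by simp) (by simp)
    refine ⟨(l57_eq m s u v w x ▸ h).isNilpotent_of_triangular, ⟨fun ⟨_, c, D, hD⟩ =>
      (h.l57_of_soliton hm hv hx hD).1, ?_⟩, fun c D hD => ?_⟩
    · rintro ⟨rfl, rfl, rfl, rfl, rfl⟩
      exact h.l57_isNilsoliton (two_div_sqrt_three_mul_sq _)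
    · obtain ⟨⟨rfl, rfl, rfl, rfl, rfl⟩, rfl⟩ := h.l57_of_soliton hm hv hx hD
      exact ⟨rfl, h.l57_isDiagonal (two_div_sqrt_three_mul_sq _) hD⟩
  · intro m s u v w x hm hv hx hs
    refine ⟨?_, fun A ⟨E, h⟩ => ?_⟩
    · rw [l57_eq]
      exact exists_hasStructureConstants_triangularBracket _ _ _ _ _ _ _ _ (by simp) (by simp)
    exact ⟨(l57_eq m s u v w x ▸ h).isNilpotent_of_triangular, fun ⟨_, c, D, hD⟩ =>
      hs.ne' (h.l57_eq_zero_of_soliton hm.ne' hv.ne' hx.ne' hD).1⟩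
  · intro m s u v w x y hm hv hx hy _ _
    refine ⟨?_, fun A E h => ?_⟩
    · rw [l56_eq]
      exact exists_hasStructureConstants_triangularBracket _ _ _ _ _ _ _ _ (by simp) (by simp)
    refine ⟨(l56_eq m s u v w x y ▸ h).isNilpotent_of_triangular, ⟨fun ⟨_, c, D, hD⟩ =>
      (h.l56_of_soliton hm hv hx hy hD).1, ?_⟩, fun c D hD => ?_⟩
    · rintro ⟨rfl, rfl, rfl, h1, h2, h3⟩
      simp only [neg_mul, ← sq_eq_sq_iff_eq_or_eq_neg, sqrt_three_half_sq] at h1 h2 h3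
      exact h.l56_isNilsoliton h1 h2 h3
    · obtain ⟨⟨rfl, rfl, rfl, h1, h2, h3⟩, rfl⟩ := h.l56_of_soliton hm hv hx hy hD
      simp only [neg_mul, ← sq_eq_sq_iff_eq_or_eq_neg, sqrt_three_half_sq] at h1 h2 h3
      exact ⟨rfl, h.l56_isDiagonal h1 h2 h3 hD⟩
  · intro m s u v w x y hm hv hx hy hs
    refine ⟨?_, fun A ⟨E, h⟩ => ?_⟩
    · rw [l56_eq]
      exact exists_hasStructureConstants_triangularBracket _ _ _ _ _ _ _ _ (by simp) (by simp)
    exact ⟨(l56_eq m s u v w x y ▸ h).isNilpotent_of_triangular, fun ⟨_, c, D, hD⟩ =>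
      hs.ne' (h.l56_eq_zero_of_soliton hm hv hx hD).1⟩
  · intro m s u v w _ _ hm hv hw
    refine ⟨?_, fun A E h => ?_⟩
    · rw [l55_eq]
      exact exists_hasStructureConstants_triangularBracket _ _ _ _ _ _ _ _ (by simp) (by simp)
    refine ⟨(l55_eq m s u v w ▸ h).isNilpotent_of_triangular, ⟨fun ⟨_, c, D, hD⟩ =>
      (h.l55_of_soliton hm hv hw hD).1, ?_⟩, fun c D hD => ?_⟩
    · rintro ⟨rfl, rfl, rfl, rfl⟩
      exact h.l55_isNilsoliton (sqrt_two_div_two_mul_sq _)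
    · obtain ⟨⟨rfl, rfl, rfl, rfl⟩, rfl⟩ := h.l55_of_soliton hm hv hw hD
      exact ⟨rfl, h.l55_isDiagonal (sqrt_two_div_two_mul_sq _) hD⟩
  · intro m s u v w hm hv hw _ _
    refine ⟨?_, fun A ⟨E, h⟩ => ?_⟩
    · rw [l59_eq]
      exact exists_hasStructureConstants_triangularBracket _ _ _ _ _ _ _ _ (by simp) (by simp)
    exact ⟨(l59_eq m s u v w ▸ h).isNilpotent_of_triangular, fun ⟨_, c, D, hD⟩ =>
      hw.ne' (h.l59_of_soliton hm hv (hv.trans hw) hD).2.2.1⟩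
  · rintro m s u v w hm hv rfl _ rfl
    refine ⟨?_, fun A E h => ?_⟩
    · rw [l59_eq]
      exact exists_hasStructureConstants_triangularBracket _ _ _ _ _ _ _ _ (by simp) (by simp)
    refine ⟨(l59_eq m s 0 w w ▸ h).isNilpotent_of_triangular, ⟨fun ⟨_, c, D, hD⟩ => ?_, ?_⟩,
      fun c D hD => ?_⟩
    · obtain ⟨hs, -, -, hw, -⟩ := h.l59_of_soliton hm hv hv hD
      exact ⟨hs, hw⟩
    · rintro ⟨rfl, rfl⟩
      exact h.l59_isNilsoliton (sqrt_three_div_two_mul_sq _)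
    · obtain ⟨rfl, -, -, rfl, rfl⟩ := h.l59_of_soliton hm hv hv hD
      exact ⟨rfl, h.l59_isDiagonal (sqrt_three_div_two_mul_sq _) hD⟩
  · intro A
    refine ⟨⟨?_, fun H => ?_⟩, ⟨?_, fun H => ?_⟩, ⟨?_, fun H => ?_⟩, ⟨?_, fun H => ?_⟩,
      ⟨?_, fun H => ?_⟩, ⟨?_, fun H => ?_⟩, ⟨?_, fun H => ?_⟩,
      fun i j hi hj => hi.lauret_injective hj⟩
    · rintro ⟨⟨_, c, D, hD⟩, s, m, hm, hs, E, h⟩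
      obtain ⟨rfl, -⟩ := h.heis5_of_soliton hm hs hD
      exact h.heis5_isHomotheticTo hm
    · obtain ⟨m, hm, E, h⟩ := H.exists_heis5
      exact ⟨h.heis5_isNilsoliton, m, m, hm, le_rfl, E, h⟩
    · rintro ⟨⟨_, c, D, hD⟩, m, s, hs, hm, E, h⟩
      obtain ⟨rfl, -⟩ := h.twoStepCentre2_of_soliton hs hm hD
      exact h.twoStepCentre2_isHomotheticTo hs
    · obtain ⟨m, hm, E, h⟩ := H.exists_twoStepCentre2
      exact ⟨h.twoStepCentre2_isNilsoliton, m, m, hm, le_rfl, E, h⟩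
    · rintro ⟨-, m, hm, E, h⟩
      exact h.twoStepCentre3_isHomotheticTo hm
    · obtain ⟨m, hm, E, h⟩ := H.exists_twoStepCentre3
      exact ⟨h.twoStepCentre3_isNilsoliton, m, hm, E, h⟩
    · rintro ⟨⟨_, c, D, hD⟩, m, s, u, v, w, x, hm, hv, hx, -, -, E, h⟩
      obtain ⟨⟨rfl, rfl, rfl, rfl, rfl⟩, -⟩ := h.l57_of_soliton hm hv hx hD
      exact h.l57_isHomotheticTo hm
    · obtain ⟨m, v, hm, hv, hvm, E, h⟩ := H.exists_l57
      exact ⟨h.l57_isNilsoliton hvm, m, 0, 0, v, 0, m, hm, hv, hm, rfl, le_rfl, E, h⟩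
    · rintro ⟨⟨_, c, D, hD⟩, m, s, u, v, w, x, y, hm, hv, hx, hy, -, -, E, h⟩
      obtain ⟨⟨rfl, rfl, rfl, h1, h2, h3⟩, -⟩ := h.l56_of_soliton hm hv hx hy hD
      exact h.l56_isHomotheticTo hx h1 h2 h3
    · obtain ⟨m, x, hm, hx, hmx, E, h⟩ := H.exists_l56
      exact ⟨h.l56_isNilsoliton hmx hmx rfl, m, 0, 0, m, 0, x, x, hm.ne', hm.ne', hx.ne', hx.ne',
        rfl, le_rfl, E, h⟩
    · rintro ⟨⟨_, c, D, hD⟩, m, s, u, v, w, -, -, hm, hv, hw, E, h⟩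
      obtain ⟨⟨rfl, rfl, rfl, rfl⟩, -⟩ := h.l55_of_soliton hm hv hw hD
      exact h.l55_isHomotheticTo hm
    · obtain ⟨m, w, hm, hw, hwm, E, h⟩ := H.exists_l55
      exact ⟨h.l55_isNilsoliton hwm, m, 0, 0, m, w, le_rfl, le_rfl, hm, hm, hw, E, h⟩
    · rintro ⟨⟨_, c, D, hD⟩, m, s, u, v, w, hm, hv, rfl, -, rfl, E, h⟩
      obtain ⟨rfl, -, -, rfl, -⟩ := h.l59_of_soliton hm hv hv hD
      exact h.l59_isHomotheticTo hm
    · obtain ⟨m, v, hm, hv, hvm, E, h⟩ := H.exists_l59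
      exact ⟨h.l59_isNilsoliton hvm, m, 0, 0, v, v, hm, hv, rfl, le_rfl, rfl, E, h⟩
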